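/- Let $N,d\ge 1$ be integers, $\beta>0$, and let $\mathbb M_d$ (resp. $\mathfrak M_d$) be the space of real (resp. invertible real) $d\times d$ matrices; write $\sigma_1(X)\ge\cdots\ge\sigma_d(X)$ for the singular values of $X$. Equip $\mathfrak M_d$ with the metric $$g^N_X(Z,W)=\operatorname{Tr}\big(Z^T\mathcal A_{N,X}^{-1}W\big),\qquad \mathcal A_{N,X}(P)=\sum_{p=1}^N (XX^T)^{\frac{N-p}{N}}\,P\,(X^TX)^{\frac{p-1}{N}} .$$ Let $E(X)=g\big(\sum_i f(\sigma_i(X))\big)$ on $\mathfrak M_d$ with $g:\mathbb R\to\mathbb R$ nondecreasing, $f:(0,\infty)\to\mathbb R$ convex, and $f,g$ of class $C^2$. For $\sigma\in(0,\infty)^d$ put $E(\sigma)=g(\sum_i f(\sigma_i))$ and $$S_N(\sigma)=(N-1)c_d+\tfrac12\sum_{i<j}\log\frac{\sigma_i^2-\sigma_j^2}{\sigma_i^{2/N}-\sigma_j^{2/N}},$$ where $c_d$ is a real constant depending only on $d$ (its value, the volume of $O_d$, plays no role) and where the quotient is replaced by its limit $N\sigma_i^{2-2/N}$ if $\sigma_i=\sigma_j$;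 let $S_N(X)=S_N(\sigma_1(X),\dots,\sigma_d(X))$ and $F_\beta=E-\beta^{-1}S_N$. Let $\sigma_\star>0$ satisfy $$g'\big(d f(\sigma_\star)\big)f'(\sigma_\star)=\beta^{-1}\frac{d-1}{2\sigma_\star}\Big(1-\frac1N\Big),$$ and let $Q\in O_d$, $X_\star=\sigma_\star Q$ and $\mathcal O_\star=\{\sigma_\star R:R\in O_d\}$. Then the Euclidean Hessians of $E(\sigma)$ and $S_N(\sigma)$ at $\vec\sigma_\star=(\sigma_\star,\dots,\sigma_\star)$ act as scalars $\theta_{\mathbf 1}(E),\theta_{\mathbf 1}(S_N)$ on $\operatorname{span}\{\mathbf 1\}$ and $\theta_\perp(E),\theta_\perp(S_N)$ on $\operatorname{span}\{\mathbf 1\}^\perp$; set $$\rho_{\mathbf 1}=-N\sigma_\star^{2-2/N}\big(\theta_{\mathbf 1}(E)-\beta^{-1}\theta_{\mathbf 1}(S_N)\big),\qquad \rho_\perp=-N\sigma_\star^{2-2/N}\big(\theta_\perp(E)-\beta^{-1}\theta_\perp(S_N)\big).$$ The vector field of the gradient flow $\dot X=-\operatorname{grad}_{g^N}F_\beta(X)$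 is defined near $X_\star$, vanishes at $X_\star$ and is differentiable there, and its linearization at $X_\star$ diagonalizes in the splitting $$\mathbb M_d=T_{X_\star}\mathcal O_\star\oplus\operatorname{span}\{X_\star\}\oplus\{QS:S^T=S,\ \operatorname{tr}S=0\},\qquad T_{X_\star}\mathcal O_\star=\{X_\star A:A^T=-A\},$$ acting as $0$ on $T_{X_\star}\mathcal O_\star$, as $\rho_{\mathbf 1}$ on $\operatorname{span}\{X_\star\}$ and as $\rho_\perp$ on $\{QS:S^T=S,\ \operatorname{tr}S=0\}$. -/

import Mathlib

open Matrix Set Filter Topology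

namespace DLN

/-- The `i`-th singular value `σ_i(X)` of a square real matrix, in decreasing order. -/
noncomputable def sv {d : ℕ} (X : Matrix (Fin d) (Fin d) ℝ) (i : Fin d) : ℝ :=
  (Matrix.toEuclideanLin X).singularValues (i : ℕ)

/-- `E` is the spectral energy `E(X) = g (∑ i, f (σ_i(X)))` on invertible matrices, with `g`
nondecreasing and `f` convex on `(0, ∞)`. Only the values of `f` on `(0, ∞)` are used. -/
structure IsSpectralEnergy {d : ℕ} (E : Matrix (Fin d) (Fin d) ℝ → ℝ) (f g : ℝ → ℝ) : Prop where
  mono : Monotone g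
  convex : ConvexOn ℝ (Ioi 0) f
  eq : ∀ X : Matrix (Fin d) (Fin d) ℝ, IsUnit X → E X = g (∑ i, f (sv X i))

/-- The energy `E(σ) = g (∑ i, f (σ_i))` as a function of `σ ∈ (0, ∞)^d`. -/
noncomputable def energyOf {d : ℕ} (f g : ℝ → ℝ) (s : Fin d → ℝ) : ℝ :=
  g (∑ i, f (s i))

/-- The ratio `(a² - b²) / (a^{2/N} - b^{2/N})` for `a, b > 0`, extended continuously
(in fact analytically) to `a = b` by its limit `N a^{2 - 2/N}`. -/
noncomputable def ratio (N : ℕ) (a b : ℝ) : ℝ :=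
  if a = b then (N : ℝ) * a ^ (2 - 2 / (N : ℝ))
  else (a ^ 2 - b ^ 2) / (a ^ (2 / (N : ℝ)) - b ^ (2 / (N : ℝ)))

/-- The entropy `S_N(σ)` on `(0, ∞)^d`, where `c` stands for the additive constant `c_d`. -/
noncomputable def entropyOf (N : ℕ) (c : ℝ) {d : ℕ} (s : Fin d → ℝ) : ℝ :=
  ((N : ℝ) - 1) * c
    + 1 / 2 * ∑ i : Fin d, ∑ j ∈ Finset.univ.filter (fun j => i < j), Real.log (ratio N (s i) (s j))

/-- The entropy `S_N(X)` of a matrix. -/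
noncomputable def entropy (N : ℕ) (c : ℝ) {d : ℕ} (X : Matrix (Fin d) (Fin d) ℝ) : ℝ :=
  entropyOf N c (sv X)

/-- The free energy `F_β = E - β⁻¹ S_N` on matrices. -/
noncomputable def freeEnergy (N : ℕ) (c β : ℝ) {d : ℕ} (E : Matrix (Fin d) (Fin d) ℝ → ℝ)
    (X : Matrix (Fin d) (Fin d) ℝ) : ℝ :=
  E X - β⁻¹ * entropy N c X

/-- The operator `P ↦ ∑_{p=1}^N (X Xᵀ)^{(N-p)/N} P (Xᵀ X)^{(p-1)/N}`; the real powers of the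
positive semidefinite matrices are taken by functional calculus. -/
noncomputable def opA (N : ℕ) {d : ℕ} (X : Matrix (Fin d) (Fin d) ℝ) :
    Module.End ℝ (Matrix (Fin d) (Fin d) ℝ) :=
  ∑ p ∈ Finset.Icc 1 N, LinearMap.mulLeftRight ℝ
    (cfc (fun t : ℝ => t ^ (((N : ℝ) - (p : ℝ)) / (N : ℝ))) (X * Xᵀ),
     cfc (fun t : ℝ => t ^ (((p : ℝ) - 1) / (N : ℝ))) (Xᵀ * X))

/-- The metric `g^N` at `X`: `g^N_X(Z, W) = Tr (Zᵀ 𝒜_{N,X}⁻¹ W)`. The operator is invertible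
at every invertible `X`. -/
noncomputable def metric (N : ℕ) {d : ℕ} (X Z W : Matrix (Fin d) (Fin d) ℝ) : ℝ :=
  Matrix.trace (Zᵀ * Ring.inverse (opA N X) W)

/-- `Z` is the Riemannian gradient of `F` at `X`: `F` is differentiable at `X` and
`g^N_X(Z, W) = dF(X)[W]` for all `W`. -/
def IsGradAt (N : ℕ) {d : ℕ} (F : Matrix (Fin d) (Fin d) ℝ → ℝ)
    (X Z : Matrix (Fin d) (Fin d) ℝ) : Prop :=
  DifferentiableAt ℝ F X ∧ ∀ W, metric N X Z W = fderiv ℝ F X W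

/-- The Riemannian gradient `grad_{g^N} F (X)`. -/
noncomputable def grad (N : ℕ) {d : ℕ} (F : Matrix (Fin d) (Fin d) ℝ → ℝ)
    (X : Matrix (Fin d) (Fin d) ℝ) : Matrix (Fin d) (Fin d) ℝ :=
  Classical.epsilon (IsGradAt N F X)

/-- The Euclidean Hessian matrix `(∂²φ / ∂σ_i ∂σ_j)(s)`. -/
noncomputable def hess {d : ℕ} (φ : (Fin d → ℝ) → ℝ) (s : Fin d → ℝ) :
    Matrix (Fin d) (Fin d) ℝ :=
  Matrix.of fun i j =>
    fderiv ℝ (fun t => fderiv ℝ φ t (Pi.single j (1 : ℝ))) s (Pi.single i (1 : ℝ))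

/-- `θ₁` is the eigenvalue of `H` on `span {𝟏}` and `θp` the eigenvalue of `H` on the
orthogonal complement `{v : ∑ i, v i = 0}` (no condition on `θp` if that complement is zero). -/
def HasEigs {d : ℕ} (H : Matrix (Fin d) (Fin d) ℝ) (θ₁ θp : ℝ) : Prop :=
  (∀ v ∈ Submodule.span ℝ {(fun _ => 1 : Fin d → ℝ)}, H *ᵥ v = θ₁ • v) ∧
    ∀ v : Fin d → ℝ, ∑ i, v i = 0 → H *ᵥ v = θp • v

/-- The rate `-N σ^{2-2/N} (θ(E) - β⁻¹ θ(S_N))`. -/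
noncomputable def rate (N : ℕ) (β σ θE θS : ℝ) : ℝ :=
  -((N : ℝ) * σ ^ (2 - 2 / (N : ℝ)) * (θE - β⁻¹ * θS))

/-- The orbit `{σ Q : Q ∈ O_d}`. -/
def orbit (d : ℕ) (σ : ℝ) : Set (Matrix (Fin d) (Fin d) ℝ) :=
  {X | ∃ Q ∈ Matrix.orthogonalGroup (Fin d) ℝ, X = σ • Q}

/-- The tangent space at `X` of a submanifold `S` of the space of matrices: the span of the
velocities at `X` of the curves in `S` through `X`. -/
def tangentSpaceAt {d : ℕ} (S : Set (Matrix (Fin d) (Fin d) ℝ)) (X : Matrix (Fin d) (Fin d) ℝ) :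
    Submodule ℝ (Matrix (Fin d) (Fin d) ℝ) :=
  Submodule.span ℝ
    {Z | ∃ γ : ℝ → Matrix (Fin d) (Fin d) ℝ, (∀ t, γ t ∈ S) ∧ γ 0 = X ∧ HasDerivAt γ Z 0}

/-- The subspace `{Q S : Sᵀ = S, tr S = 0}`. -/
def shapeSpace {d : ℕ} (Q : Matrix (Fin d) (Fin d) ℝ) :
    Submodule ℝ (Matrix (Fin d) (Fin d) ℝ) where
  carrier := {Z | ∃ S : Matrix (Fin d) (Fin d) ℝ, Sᵀ = S ∧ S.trace = 0 ∧ Z = Q * S}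
  add_mem' := by
    rintro _ _ ⟨S, hS, tS, rfl⟩ ⟨T, hT, tT, rfl⟩
    exact ⟨S + T, by simp [hS, hT], by simp [tS, tT], by rw [mul_add]⟩
  zero_mem' := ⟨0, by simp, by simp, by simp⟩
  smul_mem' := by
    rintro a _ ⟨S, hS, tS, rfl⟩
    exact ⟨a • S, by simp [hS], by simp [tS], by simp⟩

end DLN

/-!
Near `X` the free energy is `F = φ ∘ sv` with `φ` symmetric in the singular values, hence a
symmetric function of the eigenvalues of `YᵀY`. Birkhoff's theorem carries the second-order Taylor
estimate of such a function over from eigenvalues to matrices, so `F` is differentiable at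
`Y = V diag(s) Uᵀ` with Euclidean gradient `V diag(∇φ(s)) Uᵀ`. In the singular bases `𝒜_{N,Y}`
multiplies the `(i, j)` entry by `ratio N (s i) (s j)`, whose diagonal value is `N (s i)^{2-2/N}`;
therefore `grad F (Y) = V diag(N s^{2-2/N} ∇φ(s)) Uᵀ`, which is `Y` times a spectral function of
`YᵀY`. At `X` with `XᵀX = σ²` the balance condition says that `∇φ` vanishes, and the Hessian of `φ`
commutes with permutations, so the linearization in the direction `W` is `X` times a combination of
`XᵀW + WᵀX` and its trace. These vanish on tangent directions to the orbit, and the two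
combinations on the other summands are multiplications by scalars.
-/

namespace DLN

open scoped Matrix.Norms.L2Operator

/-- A symmetric function on `ℝⁿ`. -/
def IsSymmFun {n : Type*} (Ψ : (n → ℝ) → ℝ) : Prop :=
  ∀ (π : Equiv.Perm n) (x : n → ℝ), Ψ (x ∘ π) = Ψ x

theorem IsSymmFun.comp_coordinates {n : Type*} {Ψ : (n → ℝ) → ℝ} (hΨ : IsSymmFun Ψ) (f : ℝ → ℝ) :
    IsSymmFun fun x => Ψ (f ∘ x) :=
  fun π x => hΨ π (f ∘ x)

section Conjugation

variable {n : Type*} [Fintype n] [DecidableEq n]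

theorem orthogonal_transpose_mul_self (U : orthogonalGroup n ℝ) :
    (U : Matrix n n ℝ)ᵀ * U = 1 :=
  (mem_orthogonalGroup_iff' n ℝ).mp U.2

theorem orthogonal_mul_transpose_self (U : orthogonalGroup n ℝ) :
    U * (U : Matrix n n ℝ)ᵀ = 1 :=
  (mem_orthogonalGroup_iff n ℝ).mp U.2

/-- The algebra homomorphism `l ↦ U diag(l) Uᵀ`, the functional calculus of symmetric matrices
diagonalized by the columns of `U`. -/
noncomputable def conjDiagonal (U : orthogonalGroup n ℝ) : (n → ℝ) →ₐ[ℝ] Matrix n n ℝ :=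
  (Unitary.conjStarAlgAut ℝ (Matrix n n ℝ) U).toAlgEquiv.toAlgHom.comp (diagonalAlgHom ℝ)

theorem conjDiagonal_apply (U : orthogonalGroup n ℝ) (l : n → ℝ) :
    conjDiagonal U l = U * diagonal l * (U : Matrix n n ℝ)ᵀ :=
  rfl

theorem conjDiagonal_const (U : orthogonalGroup n ℝ) (s : ℝ) :
    conjDiagonal U (fun _ => s) = s • 1 :=
  (AlgHom.commutes _ s).trans (Algebra.algebraMap_eq_smul_one s)

theorem isSymm_conjDiagonal (U : orthogonalGroup n ℝ) (l : n → ℝ) :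
    (conjDiagonal U l).IsSymm := by
  simp [conjDiagonal_apply, IsSymm, mul_assoc]

theorem trace_conjDiagonal (U : orthogonalGroup n ℝ) (l : n → ℝ) :
    (conjDiagonal U l).trace = ∑ i, l i := by
  rw [conjDiagonal_apply, trace_mul_cycle, orthogonal_transpose_mul_self, one_mul,
    trace_diagonal]

theorem norm_conjDiagonal (U : orthogonalGroup n ℝ) (l : n → ℝ) : ‖conjDiagonal U l‖ = ‖l‖ := by
  rw [conjDiagonal_apply]
  exact (CStarRing.norm_mul_mem_unitary _ (Unitary.star_mem U.2)).trans
    ((CStarRing.norm_mem_unitary_mul _ U.2).trans (l2_opNorm_diagonal l))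

theorem cfc_conjDiagonal (φ : ℝ → ℝ) (U : orthogonalGroup n ℝ) (l : n → ℝ) :
    cfc φ (conjDiagonal U l) = conjDiagonal U (φ ∘ l) := by
  have hU : IsSelfAdjoint (conjDiagonal U l) := isSymm_conjDiagonal U l
  have hspec : spectrum ℝ (conjDiagonal U l) = Set.range l :=
    (AlgEquiv.spectrum_eq (Unitary.conjStarAlgAut ℝ (Matrix n n ℝ) U) _).trans
      (spectrum_diagonal l)
  classical
  obtain ⟨p, hp⟩ : ∃ p : Polynomial ℝ, ∀ i, p.eval (l i) = φ (l i) :=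
    ⟨Lagrange.interpolate (Finset.univ.image l) id φ, fun i =>
      Lagrange.eval_interpolate_at_node φ Function.injective_id.injOn
        (Finset.mem_image_of_mem l (Finset.mem_univ i))⟩
  calc cfc φ (conjDiagonal U l) = cfc p.eval (conjDiagonal U l) :=
        cfc_congr fun x hx => by obtain ⟨i, rfl⟩ := hspec.subset hx; exact (hp i).symm
    _ = conjDiagonal U (Polynomial.aeval l p) := by
        rw [cfc_polynomial p _ hU, Polynomial.aeval_algHom_apply]
    _ = conjDiagonal U (φ ∘ l) := by
        simp [Polynomial.aeval_pi_apply, hp, Function.comp_def]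

theorem sq_mem_doublyStochastic (W : orthogonalGroup n ℝ) :
    (of fun i j => W.1 i j ^ 2) ∈ doublyStochastic ℝ n := by
  rw [mem_doublyStochastic_iff_sum]
  refine ⟨fun i j => sq_nonneg _, fun i => ?_, fun j => ?_⟩
  · simpa [mul_apply, sq] using congrFun₂ (orthogonal_mul_transpose_self W) i i
  · simpa [mul_apply, sq] using congrFun₂ (orthogonal_transpose_mul_self W) j j

theorem trace_conjDiagonal_mul_conjDiagonal (U V : orthogonalGroup n ℝ) (a b : n → ℝ) :
    (conjDiagonal U a * conjDiagonal V b).trace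
      = ∑ i, ∑ j, (U⁻¹ * V).1 i j ^ 2 * (a i * b j) := by
  have hW : (U⁻¹ * V).1 = (U : Matrix n n ℝ)ᵀ * V := rfl
  calc (conjDiagonal U a * conjDiagonal V b).trace
      = (diagonal a * (U⁻¹ * V).1 * (diagonal b * (U⁻¹ * V).1ᵀ)).trace := by
        rw [conjDiagonal_apply, conjDiagonal_apply, hW, transpose_mul, transpose_transpose,
          mul_assoc U.1, mul_assoc U.1, trace_mul_comm]
        simp only [mul_assoc]
    _ = ∑ i, ∑ j, (U⁻¹ * V).1 i j ^ 2 * (a i * b j) := by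
        simp only [trace, diag, mul_apply (M := diagonal a * _), diagonal_mul, transpose_apply]
        exact Finset.sum_congr rfl fun i _ => Finset.sum_congr rfl fun j _ => by ring

/-- By Birkhoff's theorem, the doubly stochastic matrix of squared overlaps of the two bases is an
average of permutation matrices. -/
theorem exists_perm_weights_trace (U V : orthogonalGroup n ℝ) :
    ∃ w ∈ stdSimplex ℝ (Equiv.Perm n), ∀ a b : n → ℝ,
      (conjDiagonal U a * conjDiagonal V b).trace = ∑ π, w π * ∑ i, a i * b (π i) := by
  obtain ⟨w, hw0, hw1, hw⟩ :=
    exists_eq_sum_perm_of_mem_doublyStochastic (sq_mem_doublyStochastic (U⁻¹ * V))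
  refine ⟨w, ⟨hw0, hw1⟩, fun a b => ?_⟩
  have overlap (i j : n) : (U⁻¹ * V).1 i j ^ 2 = ∑ π, w π * if π i = j then 1 else 0 := by
    simpa [Matrix.sum_apply, PEquiv.toMatrix_apply] using (congrFun₂ hw i j).symm
  have row (i : n) : ∑ j, ∑ π, w π * (if π i = j then 1 else 0) * (a i * b j)
      = ∑ π, w π * (a i * b (π i)) := by
    rw [Finset.sum_comm]
    simp
  simp_rw [trace_conjDiagonal_mul_conjDiagonal, overlap, Finset.sum_mul, row, Finset.mul_sum]
  exact Finset.sum_comm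

theorem exists_perm_weights_trace_sub (U V : orthogonalGroup n ℝ) (l l' : n → ℝ) :
    ∃ w ∈ stdSimplex ℝ (Equiv.Perm n),
      (∀ v, (conjDiagonal U v * (conjDiagonal V l' - conjDiagonal U l)).trace
        = ∑ π, w π * ∑ i, v i * ((l' ∘ π) i - l i)) ∧
      ((conjDiagonal V l' - conjDiagonal U l) ^ 2).trace
        = ∑ π, w π * ∑ i, ((l' ∘ π) i - l i) ^ 2 := by
  obtain ⟨w, hw, hUV⟩ := exists_perm_weights_trace U V
  refine ⟨w, hw, fun v => ?_, ?_⟩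
  · have expand : conjDiagonal U v * (conjDiagonal V l' - conjDiagonal U l)
        = conjDiagonal U v * conjDiagonal V l' - conjDiagonal U (v * l) * conjDiagonal V 1 := by
      rw [map_one, map_mul, mul_one, mul_sub]
    rw [expand, trace_sub, hUV, hUV, ← Finset.sum_sub_distrib]
    simp [mul_sub, Finset.sum_sub_distrib]
  · have expand : ((conjDiagonal V l' - conjDiagonal U l) ^ 2).trace
        = (conjDiagonal U 1 * conjDiagonal V (l' ^ 2)).trace
          - 2 * (conjDiagonal U l * conjDiagonal V l').trace
          + (conjDiagonal U (l ^ 2) * conjDiagonal V 1).trace := by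
      rw [map_one, map_one, one_mul, mul_one, map_pow, map_pow, sq, sub_mul, mul_sub, mul_sub,
        trace_sub, trace_sub, trace_sub, trace_mul_comm (conjDiagonal V l') (conjDiagonal U l),
        sq, sq]
      ring
    rw [expand, hUV, hUV, hUV, Finset.mul_sum, ← Finset.sum_sub_distrib, ← Finset.sum_add_distrib]
    refine Finset.sum_congr rfl fun π _ => ?_
    simp only [Finset.mul_sum, ← Finset.sum_sub_distrib, ← Finset.sum_add_distrib]
    refine Finset.sum_congr rfl fun i _ => ?_
    simp only [Pi.one_apply, Pi.pow_apply, Function.comp_apply]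
    ring

theorem abs_sub_sub_trace_le {Ψ : (n → ℝ) → ℝ} (hΨ : IsSymmFun Ψ) {l l' v : n → ℝ} {C : ℝ}
    (hC : ∀ π : Equiv.Perm n, |Ψ (l' ∘ π) - Ψ l - ∑ i, v i * ((l' ∘ π) i - l i)|
      ≤ C * ∑ i, ((l' ∘ π) i - l i) ^ 2) (U V : orthogonalGroup n ℝ) :
    |Ψ l' - Ψ l - (conjDiagonal U v * (conjDiagonal V l' - conjDiagonal U l)).trace|
      ≤ C * ((conjDiagonal V l' - conjDiagonal U l) ^ 2).trace := by
  obtain ⟨w, ⟨hw0, hw1⟩, first_order, second_order⟩ := exists_perm_weights_trace_sub U V l l'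
  have average : Ψ l' - Ψ l = ∑ π, w π * (Ψ (l' ∘ π) - Ψ l) := by
    simp_rw [hΨ _ l', ← Finset.sum_mul, hw1, one_mul]
  rw [average, first_order, second_order, ← Finset.sum_sub_distrib, Finset.mul_sum]
  refine (Finset.abs_sum_le_sum_abs _ _).trans (Finset.sum_le_sum fun π _ => ?_)
  rw [← mul_sub, abs_mul, abs_of_nonneg (hw0 π), mul_left_comm C]
  exact mul_le_mul_of_nonneg_left (hC π) (hw0 π)

end Conjugation

theorem pi_norm_sq_le_sum_sq {n : Type*} [Fintype n] (x : n → ℝ) : ‖x‖ ^ 2 ≤ ∑ i, x i ^ 2 := by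
  have h0 : 0 ≤ ∑ i, x i ^ 2 := Finset.sum_nonneg fun i _ => sq_nonneg _
  rw [← Real.le_sqrt (norm_nonneg _) h0, pi_norm_le_iff_of_nonneg (Real.sqrt_nonneg _)]
  refine fun i => Real.le_sqrt_of_sq_le ?_
  rw [Real.norm_eq_abs, sq_abs]
  exact Finset.single_le_sum (f := fun i => x i ^ 2) (fun i _ => sq_nonneg _) (Finset.mem_univ i)

theorem eventually_differentiableAt_of_contDiffAt {𝕜 E F : Type*} [NontriviallyNormedField 𝕜]
    [NormedAddCommGroup E] [NormedSpace 𝕜 E] [NormedAddCommGroup F] [NormedSpace 𝕜 F] {f : E → F}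
    {x : E} (hf : ContDiffAt 𝕜 2 f x) : ∀ᶠ y in 𝓝 x, DifferentiableAt 𝕜 f y :=
  (hf.eventually (by simp)).mono fun _ hy => hy.differentiableAt (by norm_num)

section Calculus

open Asymptotics

variable {n : Type*} [Fintype n] [DecidableEq n]

/-- The vector of partial derivatives of a function on `ℝⁿ`. -/
noncomputable def partials (Ψ : (n → ℝ) → ℝ) (x : n → ℝ) (i : n) : ℝ :=
  fderiv ℝ Ψ x (Pi.single i 1)

theorem fderiv_apply_eq_sum (Ψ : (n → ℝ) → ℝ) (x v : n → ℝ) :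
    fderiv ℝ Ψ x v = ∑ i, partials Ψ x i * v i := by
  conv_lhs => rw [pi_eq_sum_univ' v, map_sum]
  exact Finset.sum_congr rfl fun i _ => by rw [map_smul, smul_eq_mul, mul_comm, partials]

theorem exists_ball_taylor_bound {Ψ : (n → ℝ) → ℝ} {x₀ : n → ℝ} (hΨ : ContDiffAt ℝ 2 Ψ x₀) :
    ∃ r > 0, ∃ C : ℝ, ∀ x ∈ Metric.ball x₀ r, ∀ y ∈ Metric.ball x₀ r,
      |Ψ y - Ψ x - ∑ i, partials Ψ x i * (y i - x i)| ≤ C * ∑ i, (y i - x i) ^ 2 := by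
  have h_fderiv : ContDiffAt ℝ 1 (fderiv ℝ Ψ) x₀ := hΨ.fderiv_right (by norm_num)
  obtain ⟨K, t, ht, hK⟩ := h_fderiv.exists_lipschitzOnWith
  obtain ⟨r, hr, hball⟩ :=
    Metric.eventually_nhds_iff_ball.mp ((eventually_differentiableAt_of_contDiffAt hΨ).and ht)
  refine ⟨r, hr, K, fun x hx y hy => ?_⟩
  have hsub : segment ℝ x y ⊆ Metric.ball x₀ r := (convex_ball x₀ r).segment_subset hx hy
  have h_sub_le : ∀ z ∈ segment ℝ x y, ‖fderiv ℝ Ψ z - fderiv ℝ Ψ x‖ ≤ K * ‖y - x‖ := fun z hz =>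
    (hK.norm_sub_le (hball z (hsub hz)).2 (hball x hx).2).trans
      (mul_le_mul_of_nonneg_left (norm_sub_le_of_mem_segment hz) K.2)
  calc |Ψ y - Ψ x - ∑ i, partials Ψ x i * (y i - x i)|
      = ‖Ψ y - Ψ x - fderiv ℝ Ψ x (y - x)‖ := by
        rw [fderiv_apply_eq_sum, Real.norm_eq_abs]; rfl
    _ ≤ K * ‖y - x‖ * ‖y - x‖ :=
        (convex_segment x y).norm_image_sub_le_of_norm_fderiv_le'
          (fun z hz => (hball z (hsub hz)).1) h_sub_le
          (left_mem_segment ℝ x y) (right_mem_segment ℝ x y)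
    _ ≤ K * ∑ i, (y i - x i) ^ 2 := by
        rw [mul_assoc, ← sq]
        exact mul_le_mul_of_nonneg_left (pi_norm_sq_le_sum_sq (y - x)) K.2

theorem norm_sub_const_eq_norm_conjDiagonal_sub {ι : Type*} {U : ι → orthogonalGroup n ℝ}
    {l : ι → n → ℝ} {x : ι} {s : ℝ} (hs : l x = fun _ => s) (y : ι) :
    ‖l y - fun _ => s‖ = ‖conjDiagonal (U y) (l y) - conjDiagonal (U x) (l x)‖ := by
  rw [hs, conjDiagonal_const, ← conjDiagonal_const (U y), ← map_sub, norm_conjDiagonal]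

theorem tendsto_of_continuousAt_conjDiagonal {ι : Type*} [TopologicalSpace ι]
    {U : ι → orthogonalGroup n ℝ} {l : ι → n → ℝ} {x : ι} {s : ℝ}
    (hM : ContinuousAt (fun y => conjDiagonal (U y) (l y)) x) (hs : l x = fun _ => s) :
    Tendsto l (𝓝 x) (𝓝 fun _ => s) := by
  rw [tendsto_iff_norm_sub_tendsto_zero]
  simp_rw [norm_sub_const_eq_norm_conjDiagonal_sub (U := U) hs]
  exact tendsto_iff_norm_sub_tendsto_zero.mp hM

variable {E : Type*} [NormedAddCommGroup E] [NormedSpace ℝ E] {U : E → orthogonalGroup n ℝ}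
  {l : E → n → ℝ} {x : E} {s : ℝ}

theorem hasFDerivAt_conjDiagonal_comp {M' : E →L[ℝ] Matrix n n ℝ}
    (hM : HasFDerivAt (fun y => conjDiagonal (U y) (l y)) M' x) (hs : l x = fun _ => s)
    {v : (n → ℝ) → n → ℝ} {v' : (n → ℝ) →L[ℝ] n → ℝ} (hv : HasFDerivAt v v' fun _ => s)
    (hv0 : v (fun _ => s) = 0) {A : Matrix n n ℝ →L[ℝ] Matrix n n ℝ}
    (hA : ∀ U a, A (conjDiagonal U a) = conjDiagonal U (v' a)) :
    HasFDerivAt (fun y => conjDiagonal (U y) (v (l y))) (A ∘L M') x := by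
  have hlO : (fun y => l y - fun _ => s) =O[𝓝 x] fun y => y - x :=
    (isBigO_of_le _ fun y => (norm_sub_const_eq_norm_conjDiagonal_sub (U := U) hs y).le).trans
      hM.isBigO_sub
  have hvo : (fun y => v (l y) - v (fun _ => s) - v' (l y - fun _ => s)) =o[𝓝 x] fun y => y - x :=
    ((hasFDerivAt_iff_isLittleO.mp hv).comp_tendsto
      (tendsto_of_continuousAt_conjDiagonal hM.continuousAt hs)).trans_isBigO hlO
  have h_spectral : (fun y => conjDiagonal (U y) (v (l y) - v (fun _ => s) - v' (l y - fun _ => s)))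
      =o[𝓝 x] fun y => y - x :=
    (isBigO_of_le _ fun y => (norm_conjDiagonal (U y) _).le).trans_isLittleO hvo
  have h_linear := A.isBigO_comp (fun y => conjDiagonal (U y) (l y) - conjDiagonal (U x) (l x)
    - M' (y - x)) (𝓝 x) |>.trans_isLittleO (hasFDerivAt_iff_isLittleO.mp hM)
  refine hasFDerivAt_iff_isLittleO.mpr ((h_spectral.add h_linear).congr_left fun y => ?_)
  have hMx : conjDiagonal (U x) (l x) = conjDiagonal (U y) (fun _ => s) := by
    rw [hs, conjDiagonal_const, conjDiagonal_const]
  rw [hMx, ← map_sub (conjDiagonal (U y)), map_sub A, hA, hs, hv0, map_sub (conjDiagonal (U y)),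
    sub_zero, map_zero, sub_zero]
  simp

/-- The linear functional `A ↦ tr (G A)`. -/
noncomputable def traceMulLeft (G : Matrix n n ℝ) : Matrix n n ℝ →L[ℝ] ℝ :=
  (traceLinearMap n ℝ ℝ ∘ₗ LinearMap.mulLeft ℝ G).toContinuousLinearMap

theorem traceMulLeft_apply (G A : Matrix n n ℝ) : traceMulLeft G A = (G * A).trace :=
  rfl

theorem isBigO_trace_sq : (fun A : Matrix n n ℝ => (A ^ 2).trace) =O[⊤] fun A => ‖A‖ ^ 2 := by
  refine ((traceMulLeft 1).isBigO_comp (fun A : Matrix n n ℝ => A ^ 2) ⊤).congr_left (fun A => ?_)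
    |>.trans ?_
  · rw [traceMulLeft_apply, one_mul]
  · exact isBigO_of_le _ fun A => by simpa using norm_pow_le' A two_pos

theorem eventually_hasFDerivAt_comp_of_isSymmFun
    (hM : ContinuousAt (fun y => conjDiagonal (U y) (l y)) x) (hs : l x = fun _ => s)
    {Ψ : (n → ℝ) → ℝ} (hsymm : IsSymmFun Ψ) (hΨ : ContDiffAt ℝ 2 Ψ fun _ => s) :
    ∀ᶠ y in 𝓝 x, ∀ M', HasFDerivAt (fun z => conjDiagonal (U z) (l z)) M' y →
      HasFDerivAt (fun z => Ψ (l z))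
        (traceMulLeft (conjDiagonal (U y) (partials Ψ (l y))) ∘L M') y := by
  obtain ⟨r, hr, C, hC⟩ := exists_ball_taylor_bound hΨ
  have perm_mem_ball (a : n → ℝ) (ha : a ∈ Metric.ball (fun _ => s) r) (π : Equiv.Perm n) :
      a ∘ π ∈ Metric.ball (fun _ => s) r := by
    rw [Metric.mem_ball, dist_pi_lt_iff hr] at ha ⊢
    exact fun i => ha (π i)
  have h_ball := (tendsto_of_continuousAt_conjDiagonal hM hs).eventually (Metric.ball_mem_nhds _ hr)
  filter_upwards [h_ball.eventually_nhds] with y hy M' hM'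
  set M := fun z => conjDiagonal (U z) (l z)
  set G := conjDiagonal (U y) (partials Ψ (l y))
  have h_quadratic : (fun z => Ψ (l z) - Ψ (l y) - traceMulLeft G (M z - M y))
      =o[𝓝 y] fun z => z - y := by
    have h_trace : (fun z => Ψ (l z) - Ψ (l y) - traceMulLeft G (M z - M y))
        =O[𝓝 y] fun z => ((M z - M y) ^ 2).trace :=
      .of_bound ‖C‖ <| hy.mono fun z hz => by
        rw [← norm_mul]
        exact (abs_sub_sub_trace_le hsymm
          (fun π => hC (l y) hy.self_of_nhds _ (perm_mem_ball _ hz π)) (U y) (U z)).trans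
          (Real.le_norm_self _)
    have h_sq : (fun z => ‖M z - M y‖ ^ 2) =O[𝓝 y] fun z => ‖z - y‖ ^ 2 :=
      hM'.isBigO_sub.norm_norm.pow 2
    exact (h_trace.trans (isBigO_trace_sq.comp_tendsto tendsto_top)).trans_isLittleO
      (h_sq.trans_isLittleO (isLittleO_pow_sub_sub y one_lt_two))
  have h_linear := (traceMulLeft G).isBigO_comp (fun z => M z - M y - M' (z - y)) (𝓝 y)
    |>.trans_isLittleO (hasFDerivAt_iff_isLittleO.mp hM')
  refine hasFDerivAt_iff_isLittleO.mpr ((h_quadratic.add h_linear).congr_left fun z => ?_)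
  simp

theorem differentiableAt_partials {Ψ : (n → ℝ) → ℝ} {x : n → ℝ} (hΨ : ContDiffAt ℝ 2 Ψ x) (i : n) :
    DifferentiableAt ℝ (fun t => partials Ψ t i) x := by
  have h_fderiv : ContDiffAt ℝ 1 (fderiv ℝ Ψ) x := hΨ.fderiv_right (by norm_num)
  exact (h_fderiv.differentiableAt (by norm_num)).clm_apply (differentiableAt_const _)

theorem eventually_partials_sub_const_mul {Φ Ψ : (n → ℝ) → ℝ} {x : n → ℝ}
    (hΦ : ContDiffAt ℝ 2 Φ x) (hΨ : ContDiffAt ℝ 2 Ψ x) (c : ℝ) :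
    ∀ᶠ y in 𝓝 x, partials (fun t => Φ t - c * Ψ t) y = partials Φ y - c • partials Ψ y := by
  filter_upwards [eventually_differentiableAt_of_contDiffAt hΦ,
    eventually_differentiableAt_of_contDiffAt hΨ] with y h₁ h₂
  ext i
  simp only [partials, fderiv_fun_sub h₁ (h₂.const_mul c), fderiv_const_mul h₂]
  rfl

end Calculus

section SymmetricPartials

variable {n : Type*} [Finite n] [DecidableEq n]

theorem partials_comp_perm (Ψ : (n → ℝ) → ℝ) (π : Equiv.Perm n) (x : n → ℝ) (i : n) :
    partials (fun y => Ψ (y ∘ π)) x (π i) = partials Ψ (x ∘ π) i := by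
  cases nonempty_fintype n
  let P : (n → ℝ) ≃L[ℝ] n → ℝ := (LinearEquiv.funCongrLeft ℝ ℝ π).toContinuousLinearEquiv
  have h_single : Pi.single (π i) (1 : ℝ) ∘ π = Pi.single i 1 := by
    rw [Pi.single_comp_equiv, Equiv.symm_apply_apply]
  calc fderiv ℝ (Ψ ∘ P) x (Pi.single (π i) 1) = fderiv ℝ Ψ (x ∘ π) (Pi.single (π i) 1 ∘ π) := by
        rw [P.comp_right_fderiv]; rfl
    _ = fderiv ℝ Ψ (x ∘ π) (Pi.single i 1) := by rw [h_single]

theorem IsSymmFun.partials_perm {Ψ : (n → ℝ) → ℝ} (hΨ : IsSymmFun Ψ) (π : Equiv.Perm n)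
    (x : n → ℝ) (i : n) : partials Ψ x (π i) = partials Ψ (x ∘ π) i := by
  simpa only [hΨ π] using partials_comp_perm Ψ π x i

theorem partials_eq_zero_of_hasDerivAt {Ψ : (n → ℝ) → ℝ} (hsymm : IsSymmFun Ψ) {s : ℝ}
    (hΨ : DifferentiableAt ℝ Ψ fun _ => s) (h : HasDerivAt (fun t : ℝ => Ψ fun _ => t) 0 s) :
    partials Ψ (fun _ => s) = 0 := by
  cases nonempty_fintype n
  ext i
  have h_const (j : n) : partials Ψ (fun _ => s) j = partials Ψ (fun _ => s) i := by
    conv_lhs => rw [← Equiv.swap_apply_left i j]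
    exact hsymm.partials_perm (Equiv.swap i j) (fun _ => s) i
  have h_line : HasDerivAt (fun t : ℝ => fun _ : n => t) (fun _ => 1) s :=
    hasDerivAt_pi.mpr fun _ => hasDerivAt_id s
  have h_sum := (hΨ.hasFDerivAt.comp_hasDerivAt s h_line).unique h
  have : Nonempty n := ⟨i⟩
  simpa [fderiv_apply_eq_sum, h_const] using h_sum

end SymmetricPartials

section Isotropic

variable {n : Type*} [Fintype n] [DecidableEq n]

/-- The operator `x ↦ a x + b (∑ i, x i) 𝟏` on `ℝⁿ`, the general form of a linear operator that
commutes with all permutations of the coordinates. -/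
noncomputable def isotropicPi (a b : ℝ) : (n → ℝ) →L[ℝ] n → ℝ :=
  a • .id ℝ _ + b • (∑ i, ContinuousLinearMap.proj i : (n → ℝ) →L[ℝ] ℝ).smulRight 1

/-- The operator `A ↦ a A + b (tr A) 1` on matrices, which acts as `isotropicPi a b` on the
eigenvalues of a symmetric matrix. -/
noncomputable def isotropicMatrix (a b : ℝ) : Matrix n n ℝ →L[ℝ] Matrix n n ℝ :=
  a • .id ℝ _ + b • (traceMulLeft 1).smulRight 1

theorem isotropicMatrix_apply (a b : ℝ) (A : Matrix n n ℝ) :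
    isotropicMatrix a b A = a • A + b • A.trace • 1 := by
  simp [isotropicMatrix, traceMulLeft_apply]

theorem isotropicMatrix_conjDiagonal (a b : ℝ) (U : orthogonalGroup n ℝ) (l : n → ℝ) :
    isotropicMatrix a b (conjDiagonal U l) = conjDiagonal U (isotropicPi a b l) := by
  simp [isotropicMatrix_apply, isotropicPi, trace_conjDiagonal]

end Isotropic

section Hessian

theorem exists_eq_of_perm_invariant {n : Type*} [DecidableEq n] {H : Matrix n n ℝ}
    (hH : ∀ (π : Equiv.Perm n) i j, H (π i) (π j) = H i j) :
    ∃ a b : ℝ, H = a • 1 + of fun _ _ => b := by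
  rcases isEmpty_or_nonempty n with _ | ⟨⟨i₀⟩⟩
  · exact ⟨0, 0, Subsingleton.elim _ _⟩
  have h_diag (i : n) : H i i = H i₀ i₀ := by simpa using hH (Equiv.swap i₀ i) i₀ i₀
  rcases subsingleton_or_nontrivial n with _ | _
  · exact ⟨H i₀ i₀, 0, by ext i j; simp [Subsingleton.elim j i, h_diag]⟩
  obtain ⟨i₁, hi⟩ := exists_ne i₀
  have h_off (i j : n) (hij : i ≠ j) : H i j = H i₀ i₁ := by
    have h_ne : Equiv.swap i₀ i i₁ ≠ i := by
      simpa [Equiv.swap_apply_eq_iff] using hi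
    have := hH (Equiv.swap (Equiv.swap i₀ i i₁) j * Equiv.swap i₀ i) i₀ i₁
    rwa [Equiv.Perm.mul_apply, Equiv.Perm.mul_apply, Equiv.swap_apply_left, Equiv.swap_apply_left,
      Equiv.swap_apply_of_ne_of_ne h_ne.symm hij] at this
  refine ⟨H i₀ i₀ - H i₀ i₁, H i₀ i₁, ?_⟩
  ext i j
  rcases eq_or_ne i j with rfl | hij
  · simp [h_diag]
  · simp [h_off i j hij, hij]

variable {d : ℕ}

theorem hess_perm {φ : (Fin d → ℝ) → ℝ} (hφ : IsSymmFun φ) (π : Equiv.Perm (Fin d)) (s : ℝ)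
    (i j : Fin d) : hess φ (fun _ => s) (π i) (π j) = hess φ (fun _ => s) i j :=
  calc partials (fun t => partials φ t (π j)) (fun _ => s) (π i)
      = partials (fun t => partials φ (t ∘ π) j) (fun _ => s) (π i) := by
        simp only [hφ.partials_perm]
    _ = partials (fun t => partials φ t j) (fun _ => s) i :=
        partials_comp_perm (fun t => partials φ t j) π _ i

theorem hasEigs_smul_one_add_const (a b : ℝ) :
    HasEigs (a • 1 + of fun _ _ : Fin d => b) (a + d * b) a := by
  have h_apply (v : Fin d → ℝ) :
      (a • (1 : Matrix (Fin d) (Fin d) ℝ) + of fun _ _ => b) *ᵥ v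
        = a • v + fun _ => b * ∑ i, v i := by
    rw [add_mulVec, smul_mulVec, one_mulVec]
    ext i
    simp [mulVec, dotProduct, Finset.mul_sum]
  refine ⟨fun v hv => ?_, fun v hv => ?_⟩
  · obtain ⟨c, rfl⟩ := Submodule.mem_span_singleton.mp hv
    ext i
    simp [h_apply]
    ring
  · ext i
    simp [h_apply, hv]

theorem exists_hasEigs_hess {φ : (Fin d → ℝ) → ℝ} (hφ : IsSymmFun φ) (s : ℝ) :
    ∃ θ₁ θp, HasEigs (hess φ fun _ => s) θ₁ θp := by
  obtain ⟨a, b, hH⟩ := exists_eq_of_perm_invariant fun π i j => hess_perm hφ π s i j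
  exact ⟨a + d * b, a, hH ▸ hasEigs_smul_one_add_const a b⟩

theorem hess_sub_const_mul {φ ψ : (Fin d → ℝ) → ℝ} {x : Fin d → ℝ}
    (hφ : ContDiffAt ℝ 2 φ x) (hψ : ContDiffAt ℝ 2 ψ x) (c : ℝ) :
    hess (fun t => φ t - c * ψ t) x = hess φ x - c • hess ψ x := by
  ext i j
  have h_partials : (fun t => partials (fun t => φ t - c * ψ t) t j)
      =ᶠ[𝓝 x] fun t => partials φ t j - c * partials ψ t j :=
    (eventually_partials_sub_const_mul hφ hψ c).mono fun y hy => congrFun hy j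
  have hφ' := differentiableAt_partials hφ j
  have hψ' := differentiableAt_partials hψ j
  change fderiv ℝ (fun t => partials (fun t => φ t - c * ψ t) t j) x _ = _
  rw [h_partials.fderiv_eq, fderiv_fun_sub hφ' (hψ'.const_mul c), fderiv_const_mul hψ']
  rfl

theorem HasEigs.sub_smul {H K : Matrix (Fin d) (Fin d) ℝ} {θ₁ θp η₁ ηp : ℝ} (hH : HasEigs H θ₁ θp)
    (hK : HasEigs K η₁ ηp) (c : ℝ) : HasEigs (H - c • K) (θ₁ - c * η₁) (θp - c * ηp) := by
  refine ⟨fun v hv => ?_, fun v hv => ?_⟩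
  · rw [sub_mulVec, smul_mulVec, hH.1 v hv, hK.1 v hv, _root_.sub_smul, mul_smul]
  · rw [sub_mulVec, smul_mulVec, hH.2 v hv, hK.2 v hv, _root_.sub_smul, mul_smul]

theorem HasEigs.eq_smul_one_add_const {H : Matrix (Fin d) (Fin d) ℝ} {θ₁ θp : ℝ}
    (hH : HasEigs H θ₁ θp) : H = θp • 1 + of fun _ _ => (θ₁ - θp) / d := by
  ext i j
  have hd : (d : ℝ) ≠ 0 := Nat.cast_ne_zero.mpr i.pos.ne'
  let m : Fin d → ℝ := (d : ℝ)⁻¹ • fun _ => 1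
  have hm : H *ᵥ m = θ₁ • m := hH.1 _ (Submodule.smul_mem _ _ (Submodule.mem_span_singleton_self _))
  have h_perp : H *ᵥ (Pi.single j 1 - m) = θp • (Pi.single j 1 - m) := hH.2 _ (by simp [m, hd])
  have h_col := congrFun h_perp i
  rw [mulVec_sub, hm, mulVec_single_one] at h_col
  simp only [Pi.sub_apply, Pi.smul_apply, col_apply, smul_eq_mul, m, mul_one] at h_col
  simp only [Matrix.add_apply, Matrix.smul_apply, one_apply, of_apply, smul_eq_mul]
  rw [Pi.single_apply] at h_col
  linear_combination h_col

theorem hasFDerivAt_partials_of_hasEigs {φ : (Fin d → ℝ) → ℝ} {x : Fin d → ℝ}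
    (hφ : ContDiffAt ℝ 2 φ x) {θ₁ θp : ℝ} (hH : HasEigs (hess φ x) θ₁ θp) :
    HasFDerivAt (partials φ) (isotropicPi θp ((θ₁ - θp) / d)) x := by
  rw [hasFDerivAt_pi']
  intro i
  refine (differentiableAt_partials hφ i).hasFDerivAt.congr_fderiv ?_
  ext v
  have h_entries (j : Fin d) : partials (fun t => partials φ t i) x j
      = θp * (if j = i then 1 else 0) + (θ₁ - θp) / d :=
    (congrFun₂ hH.eq_smul_one_add_const j i).trans (by simp [one_apply])
  simp [fderiv_apply_eq_sum, h_entries, isotropicPi, add_mul, Finset.sum_add_distrib,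
    Finset.mul_sum]

end Hessian

section SingularValues

variable {d : ℕ}

theorem exists_eq_conjDiagonal_sv_sq (Y : Matrix (Fin d) (Fin d) ℝ) :
    ∃ U : orthogonalGroup (Fin d) ℝ, Yᵀ * Y = conjDiagonal U (sv Y ^ 2) := by
  set T := toEuclideanLin Y with hT
  have hn : Module.finrank ℝ (EuclideanSpace ℝ (Fin d)) = d := by simp
  set b := T.isSymmetric_adjoint_comp_self.eigenvectorBasis hn with hb
  let U : Matrix (Fin d) (Fin d) ℝ := of fun i j => b j i
  have orthonormal : Uᵀ * U = 1 := by
    ext i j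
    simpa [mul_apply, U, one_apply, PiLp.inner_apply, mul_comm] using b.inner_eq_ite i j
  let V : orthogonalGroup (Fin d) ℝ := ⟨U, (mem_orthogonalGroup_iff' _ _).mpr orthonormal⟩
  have eigen : Yᵀ * Y * U = U * Matrix.diagonal (sv Y ^ 2) := by
    ext i j
    have h := T.isSymmetric_adjoint_comp_self.apply_eigenvectorBasis hn j
    rw [← T.sq_singularValues_fin hn j, ← hb, hT, ← toEuclideanLin_conjTranspose_eq_adjoint] at h
    have h_coord := congrArg (fun v : EuclideanSpace ℝ (Fin d) => v i) h
    simp only [LinearMap.comp_apply, toLpLin_apply, PiLp.smul_apply, RCLike.ofReal_real_eq_id,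
      id, smul_eq_mul, conjTranspose_eq_transpose_of_trivial] at h_coord
    rw [mul_assoc, mul_diagonal, mul_comm, Pi.pow_apply, sv]
    exact h_coord
  refine ⟨V, ?_⟩
  rw [conjDiagonal_apply, ← eigen, mul_assoc, orthogonal_mul_transpose_self V, mul_one]

theorem sv_nonneg (Y : Matrix (Fin d) (Fin d) ℝ) : 0 ≤ sv Y :=
  fun i => (toEuclideanLin Y).singularValues_nonneg i

theorem sqrt_comp_sv_sq (Y : Matrix (Fin d) (Fin d) ℝ) : Real.sqrt ∘ (sv Y ^ 2) = sv Y :=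
  funext fun i => Real.sqrt_sq (sv_nonneg Y i)

theorem sv_pos {Y : Matrix (Fin d) (Fin d) ℝ} (hY : IsUnit Y) (i : Fin d) : 0 < sv Y i := by
  refine (toEuclideanLin Y).injective_iff_forall_lt_finrank_singularValues_pos.1 ?_ i (by simp)
  intro v w h
  have h_mulVec := congrArg WithLp.ofLp h
  simp only [toLpLin_apply] at h_mulVec
  exact WithLp.ofLp_injective 2 (mulVec_injective_of_isUnit hY h_mulVec)

theorem sv_sq_eq_const {X : Matrix (Fin d) (Fin d) ℝ} {s : ℝ} (hX : Xᵀ * X = s • 1) :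
    sv X ^ 2 = fun _ => s := by
  obtain ⟨U, hU⟩ := exists_eq_conjDiagonal_sv_sq X
  rw [hX, ← conjDiagonal_const U, ← sub_eq_zero, ← map_sub, ← norm_eq_zero, norm_conjDiagonal,
    norm_eq_zero, sub_eq_zero] at hU
  exact hU.symm

end SingularValues

section Svd

variable {n : Type*} [Fintype n] [DecidableEq n]

/-- The linear equivalence `P ↦ V P Uᵀ`; a singular value decomposition of `Y` reads
`Y = changeBases V U (diagonal s)`. -/
noncomputable def changeBases (V U : orthogonalGroup n ℝ) : Matrix n n ℝ ≃ₗ[ℝ] Matrix n n ℝ :=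
  LinearEquiv.ofLinearMap (LinearMap.mulLeftRight ℝ ((V : Matrix n n ℝ), (U : Matrix n n ℝ)ᵀ))
    (LinearMap.mulLeftRight ℝ ((V : Matrix n n ℝ)ᵀ, (U : Matrix n n ℝ)))
    (by
      ext1 P
      calc V.1 * (V.1ᵀ * P * U.1) * U.1ᵀ = V.1 * V.1ᵀ * P * (U.1 * U.1ᵀ) := by
            simp only [mul_assoc]
        _ = P := by simp only [orthogonal_mul_transpose_self, one_mul, mul_one])
    (by
      ext1 P
      calc V.1ᵀ * (V.1 * P * U.1ᵀ) * U.1 = V.1ᵀ * V.1 * P * (U.1ᵀ * U.1) := by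
            simp only [mul_assoc]
        _ = P := by simp only [orthogonal_transpose_mul_self, one_mul, mul_one])

theorem changeBases_apply (V U : orthogonalGroup n ℝ) (P : Matrix n n ℝ) :
    changeBases V U P = V * P * (U : Matrix n n ℝ)ᵀ :=
  rfl

theorem changeBases_diagonal (U : orthogonalGroup n ℝ) (l : n → ℝ) :
    changeBases U U (diagonal l) = conjDiagonal U l :=
  rfl

theorem changeBases_mul_changeBases (V U W : orthogonalGroup n ℝ) (P R : Matrix n n ℝ) :
    changeBases V U P * changeBases U W R = changeBases V W (P * R) := by
  calc V * P * U.1ᵀ * (U * R * W.1ᵀ) = V * P * (U.1ᵀ * U) * R * W.1ᵀ := by simp only [mul_assoc]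
    _ = V * (P * R) * W.1ᵀ := by
        rw [orthogonal_transpose_mul_self, mul_one, mul_assoc V.1]

theorem transpose_changeBases (V U : orthogonalGroup n ℝ) (P : Matrix n n ℝ) :
    (changeBases V U P)ᵀ = changeBases U V Pᵀ := by
  simp only [changeBases_apply, transpose_mul, transpose_transpose, mul_assoc]

theorem exists_svd {Y : Matrix n n ℝ} {U : orthogonalGroup n ℝ} {s : n → ℝ} (hs : ∀ i, s i ≠ 0)
    (hY : Yᵀ * Y = conjDiagonal U (s ^ 2)) :
    ∃ V : orthogonalGroup n ℝ, Y = changeBases V U (diagonal s) := by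
  obtain ⟨P, rfl⟩ := (changeBases 1 U).surjective Y
  rw [transpose_changeBases, changeBases_mul_changeBases, ← changeBases_diagonal] at hY
  have hP : Pᵀ * P = Matrix.diagonal (s ^ 2) := (changeBases U U).injective hY
  have hV : (P * Matrix.diagonal s⁻¹)ᵀ * (P * Matrix.diagonal s⁻¹) = 1 := by
    calc (P * Matrix.diagonal s⁻¹)ᵀ * (P * Matrix.diagonal s⁻¹)
        = Matrix.diagonal s⁻¹ * (Pᵀ * P) * Matrix.diagonal s⁻¹ := by
          simp only [transpose_mul, diagonal_transpose, mul_assoc]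
      _ = 1 := by
          rw [hP, diagonal_mul_diagonal, diagonal_mul_diagonal, ← diagonal_one]
          congr 1
          ext i
          simp [sq, hs]
  refine ⟨⟨P * Matrix.diagonal s⁻¹, (mem_orthogonalGroup_iff' _ _).mpr hV⟩, ?_⟩
  simp [changeBases_apply, mul_assoc P, hs]

end Svd

section Metric

variable {N d : ℕ}

theorem sq_rpow_div {a : ℝ} (ha : 0 ≤ a) (k : ℕ) (q : ℝ) :
    (a ^ 2) ^ ((k : ℝ) / q) = (a ^ (2 / q)) ^ k := by
  rw [← Real.rpow_natCast, ← Real.rpow_natCast, ← Real.rpow_mul ha, ← Real.rpow_mul ha]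
  congr 1
  push_cast
  ring

theorem ratio_eq_sum (hN : 0 < N) {a b : ℝ} (ha : 0 < a) (hb : 0 < b) :
    ratio N a b = ∑ p ∈ Finset.Icc 1 N,
      (a ^ 2) ^ (((N : ℝ) - p) / N) * (b ^ 2) ^ (((p : ℝ) - 1) / N) := by
  have hN' : (N : ℝ) ≠ 0 := Nat.cast_ne_zero.mpr hN.ne'
  have h_pow (x : ℝ) (hx : 0 < x) : (x ^ (2 / (N : ℝ))) ^ N = x ^ 2 := by
    rw [← sq_rpow_div hx.le, div_self hN', Real.rpow_one]
  have h_geom : ∑ p ∈ Finset.Icc 1 N, (a ^ 2) ^ (((N : ℝ) - p) / N) * (b ^ 2) ^ (((p : ℝ) - 1) / N)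
      = ∑ p ∈ Finset.range N, (b ^ (2 / (N : ℝ))) ^ p * (a ^ (2 / (N : ℝ))) ^ (N - 1 - p) := by
    rw [← Finset.Ico_add_one_right_eq_Icc, Finset.sum_Ico_eq_sum_range]
    refine Finset.sum_congr rfl fun p hp => ?_
    have hp' : p + 1 ≤ N := Finset.mem_range.mp hp
    rw [← sq_rpow_div ha.le, ← sq_rpow_div hb.le, Nat.sub_sub, Nat.cast_sub (by lia), mul_comm]
    push_cast
    ring_nf
  rw [h_geom, ratio]
  split_ifs with h
  · subst h
    have h_term (p : ℕ) (hp : p ∈ Finset.range N) :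
        (a ^ (2 / (N : ℝ))) ^ p * (a ^ (2 / (N : ℝ))) ^ (N - 1 - p) = a ^ (2 - 2 / (N : ℝ)) := by
      rw [← pow_add, Nat.add_sub_cancel' (Nat.le_sub_one_of_lt (Finset.mem_range.mp hp)),
        ← Real.rpow_mul_natCast ha.le, Nat.cast_sub hN]
      congr 1
      push_cast
      field_simp
    rw [Finset.sum_congr rfl h_term]
    simp
  · have h_ne : a ^ (2 / (N : ℝ)) - b ^ (2 / (N : ℝ)) ≠ 0 := fun h_eq => h <| by
      rw [← pow_left_inj₀ ha.le hb.le two_ne_zero, ← h_pow a ha, ← h_pow b hb, sub_eq_zero.mp h_eq]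
    rw [div_eq_iff h_ne, ← neg_sub (b ^ (_ : ℝ)), mul_neg, (Commute.all _ _).geom_sum₂_mul, neg_sub,
      h_pow a ha, h_pow b hb]

theorem ratio_self (N : ℕ) (a : ℝ) : ratio N a a = N * a ^ (2 - 2 / (N : ℝ)) :=
  if_pos rfl

theorem ratio_pos (hN : 0 < N) {a b : ℝ} (ha : 0 < a) (hb : 0 < b) : 0 < ratio N a b := by
  rw [ratio_eq_sum hN ha hb]
  exact Finset.sum_pos (fun p _ => by positivity) ⟨1, by simp; lia⟩

theorem opA_apply (N : ℕ) (Y P : Matrix (Fin d) (Fin d) ℝ) :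
    opA N Y P = ∑ p ∈ Finset.Icc 1 N,
      cfc (fun t : ℝ => t ^ (((N : ℝ) - p) / N)) (Y * Yᵀ) * P *
      cfc (fun t : ℝ => t ^ (((p : ℝ) - 1) / N)) (Yᵀ * Y) := by
  simp [opA]

theorem opA_changeBases (hN : 0 < N) (V U : orthogonalGroup (Fin d) ℝ) {s : Fin d → ℝ}
    (hs : ∀ i, 0 < s i) (P : Matrix (Fin d) (Fin d) ℝ) :
    opA N (changeBases V U (diagonal s)) (changeBases V U P)
      = changeBases V U ((of fun i j => ratio N (s i) (s j)) ⊙ P) := by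
  have h_sq : diagonal s * diagonal s = Matrix.diagonal (s ^ 2) := by
    rw [diagonal_mul_diagonal, sq]; rfl
  rw [opA_apply, transpose_changeBases, diagonal_transpose]
  simp only [changeBases_mul_changeBases, h_sq, changeBases_diagonal, cfc_conjDiagonal]
  simp only [← changeBases_diagonal, changeBases_mul_changeBases, ← map_sum]
  congr 1
  ext i j
  rw [hadamard_apply, of_apply, ratio_eq_sum hN (hs i) (hs j), Finset.sum_mul, Matrix.sum_apply]
  refine Finset.sum_congr rfl fun p _ => ?_
  rw [mul_diagonal, diagonal_mul]
  exact mul_right_comm _ _ _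

theorem opA_mul_conjDiagonal (hN : 0 < N) {Y : Matrix (Fin d) (Fin d) ℝ}
    {U : orthogonalGroup (Fin d) ℝ} {s : Fin d → ℝ} (hs : ∀ i, 0 < s i)
    (hY : Yᵀ * Y = conjDiagonal U (s ^ 2)) (a : Fin d → ℝ) :
    opA N Y (Y * conjDiagonal U a)
      = Y * conjDiagonal U fun i => N * s i ^ (2 - 2 / (N : ℝ)) * a i := by
  obtain ⟨V, rfl⟩ := exists_svd (fun i => (hs i).ne') hY
  rw [← changeBases_diagonal, ← changeBases_diagonal, changeBases_mul_changeBases,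
    changeBases_mul_changeBases, opA_changeBases hN V U hs]
  congr 1
  ext i j
  rcases eq_or_ne i j with rfl | hij
  · simp [ratio_self]
    ring
  · simp [hij]

theorem isUnit_opA (hN : 0 < N) {Y : Matrix (Fin d) (Fin d) ℝ} (hY : IsUnit Y) :
    IsUnit (opA N Y) := by
  obtain ⟨U, hU⟩ := exists_eq_conjDiagonal_sv_sq Y
  have hs := sv_pos hY
  obtain ⟨V, hV⟩ := exists_svd (fun i => (hs i).ne') hU
  rw [LinearMap.isUnit_iff_ker_eq_bot, LinearMap.ker_eq_bot']
  intro P hP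
  obtain ⟨R, rfl⟩ := (changeBases V U).surjective P
  rw [hV, opA_changeBases hN V U hs, map_eq_zero_iff _ (changeBases V U).injective] at hP
  have hR : R = 0 := by
    ext i j
    exact (mul_eq_zero.mp (congrFun₂ hP i j)).resolve_left (ratio_pos hN (hs i) (hs j)).ne'
  rw [hR, map_zero]

theorem transpose_cfc (φ : ℝ → ℝ) (M : Matrix (Fin d) (Fin d) ℝ) : (cfc φ M)ᵀ = cfc φ M :=
  cfc_predicate (p := IsSelfAdjoint) φ M

theorem trace_opA_transpose_mul (N : ℕ) (Y P R : Matrix (Fin d) (Fin d) ℝ) :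
    trace ((opA N Y P)ᵀ * R) = trace (Pᵀ * opA N Y R) := by
  simp only [opA_apply, transpose_sum, Finset.sum_mul, Finset.mul_sum, trace_sum]
  refine Finset.sum_congr rfl fun p _ => ?_
  rw [transpose_mul, transpose_mul, transpose_cfc, transpose_cfc, mul_assoc, trace_mul_comm]
  simp only [mul_assoc]

theorem IsGradAt.eq_of_isUnit {F : Matrix (Fin d) (Fin d) ℝ → ℝ} {Y Z Z' : Matrix (Fin d) (Fin d) ℝ}
    (hY : IsUnit (opA N Y)) (hZ : IsGradAt N F Y Z) (hZ' : IsGradAt N F Y Z') : Z = Z' := by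
  have h_metric (W) : metric N Y Z (opA N Y W) = metric N Y Z' (opA N Y W) :=
    (hZ.2 _).trans (hZ'.2 _).symm
  have h_trace (W) : (Zᵀ * W).trace = (Z'ᵀ * W).trace := by
    simpa only [metric, ← Module.End.mul_apply, Ring.inverse_mul_cancel _ hY, Module.End.one_apply]
      using h_metric W
  rw [← sub_eq_zero, ← trace_conjTranspose_mul_self_eq_zero_iff,
    conjTranspose_eq_transpose_of_trivial, transpose_sub, sub_mul, trace_sub, h_trace, sub_self]

theorem isGradAt_opA {F : Matrix (Fin d) (Fin d) ℝ → ℝ} {Y G : Matrix (Fin d) (Fin d) ℝ}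
    (hY : IsUnit (opA N Y)) (hF : DifferentiableAt ℝ F Y)
    (hG : ∀ W, fderiv ℝ F Y W = trace (Gᵀ * W)) : IsGradAt N F Y (opA N Y G) := by
  refine ⟨hF, fun W => ?_⟩
  rw [metric, trace_opA_transpose_mul, ← Module.End.mul_apply, Ring.mul_inverse_cancel _ hY,
    Module.End.one_apply, hG]

theorem IsGradAt.isGradAt_grad {F : Matrix (Fin d) (Fin d) ℝ → ℝ} {Y Z : Matrix (Fin d) (Fin d) ℝ}
    (hZ : IsGradAt N F Y Z) : IsGradAt N F Y (grad N F Y) :=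
  Classical.epsilon_spec ⟨Z, hZ⟩

end Metric

section Coordinates

variable {n : Type*} {f : ℝ → ℝ} {l : n → ℝ}

theorem hasFDerivAt_comp_coordinates [Finite n] {f' : n → ℝ}
    (hf : ∀ i, HasDerivAt f (f' i) (l i)) :
    HasFDerivAt (fun m : n → ℝ => f ∘ m)
      (.pi fun i => f' i • (.proj i : (n → ℝ) →L[ℝ] ℝ)) l := by
  cases nonempty_fintype n
  exact hasFDerivAt_pi.mpr fun i => (hf i).comp_hasFDerivAt l (hasFDerivAt_apply (𝕜 := ℝ) i l)

theorem contDiffAt_comp_coordinates [Fintype n] {k : WithTop ℕ∞} {Ψ : (n → ℝ) → ℝ}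
    (hΨ : ContDiffAt ℝ k Ψ (f ∘ l)) (hf : ∀ i, ContDiffAt ℝ k f (l i)) :
    ContDiffAt ℝ k (fun m => Ψ (f ∘ m)) l :=
  hΨ.comp l (contDiffAt_pi.mpr fun i => (hf i).comp l (contDiffAt_apply ℝ ℝ i l))

theorem partials_comp_coordinates [Finite n] [DecidableEq n] {f' : n → ℝ} {Ψ : (n → ℝ) → ℝ}
    (hΨ : DifferentiableAt ℝ Ψ (f ∘ l)) (hf : ∀ i, HasDerivAt f (f' i) (l i)) (i : n) :
    partials (fun m => Ψ (f ∘ m)) l i = f' i * partials Ψ (f ∘ l) i := by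
  cases nonempty_fintype n
  have h_comp := hΨ.hasFDerivAt.comp l (hasFDerivAt_comp_coordinates hf)
  rw [partials, HasFDerivAt.fderiv (f := fun m => Ψ (f ∘ m)) h_comp]
  simp [fderiv_apply_eq_sum, Pi.single_apply, mul_comm]

end Coordinates

section Gram

variable {n : Type*} [Fintype n] [DecidableEq n]

/-- The derivative `W ↦ Xᵀ W + Wᵀ X` of the Gram matrix `Xᵀ X`. -/
noncomputable def gramDeriv (X : Matrix n n ℝ) : Matrix n n ℝ →L[ℝ] Matrix n n ℝ :=
  (LinearMap.mulLeft ℝ Xᵀ + LinearMap.mulRight ℝ X ∘ₗ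
    (transposeLinearEquiv n n ℝ ℝ).toLinearMap).toContinuousLinearMap

theorem gramDeriv_apply (X W : Matrix n n ℝ) : gramDeriv X W = Xᵀ * W + Wᵀ * X :=
  rfl

theorem hasFDerivAt_gram (X : Matrix n n ℝ) : HasFDerivAt (fun Y => Yᵀ * Y) (gramDeriv X) X := by
  have h_transpose : HasFDerivAt (fun Y : Matrix n n ℝ => Yᵀ)
      (transposeLinearEquiv n n ℝ ℝ).toLinearMap.toContinuousLinearMap X :=
    (transposeLinearEquiv n n ℝ ℝ).toLinearMap.toContinuousLinearMap.hasFDerivAt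
  exact h_transpose.mul' (hasFDerivAt_id X)

theorem trace_mul_gramDeriv {C : Matrix n n ℝ} (hC : C.IsSymm) (X W : Matrix n n ℝ) :
    (C * gramDeriv X W).trace = ((X * ((2 : ℝ) • C))ᵀ * W).trace := by
  have h_transpose : (C * (Wᵀ * X)).trace = (C * (Xᵀ * W)).trace := by
    rw [← trace_transpose, transpose_mul, transpose_mul, transpose_transpose, hC.eq,
      trace_mul_comm]
  rw [gramDeriv_apply, mul_add, trace_add, h_transpose, mul_smul_comm, transpose_smul,
    transpose_mul, hC.eq, smul_mul_assoc, trace_smul, smul_eq_mul, mul_assoc, two_mul]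

end Gram

section SpectralGradient

variable {N d : ℕ}

theorem eventually_isUnit {X : Matrix (Fin d) (Fin d) ℝ} (hX : IsUnit X) :
    ∀ᶠ Y in 𝓝 X, IsUnit Y :=
  Units.nhds hX.unit

/-- For `F` the function `φ` of the singular values, the gradient of `F` at `Y` is `Y` times
the function of `Yᵀ Y` with eigenvalues `gradWeights N φ (sv Y)`. -/
noncomputable def gradWeights (N : ℕ) (φ : (Fin d → ℝ) → ℝ) (s : Fin d → ℝ) (i : Fin d) : ℝ :=
  N * s i ^ (2 - 2 / (N : ℝ)) * ((s i)⁻¹ * partials φ s i)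

theorem hasDerivAt_sqrt_sq {s : ℝ} (hs : 0 < s) : HasDerivAt Real.sqrt (1 / (2 * s)) (s ^ 2) := by
  simpa only [Real.sqrt_sq hs.le] using Real.hasDerivAt_sqrt (pow_ne_zero 2 hs.ne')

theorem sqrt_comp_sq_const {n : Type*} {s : ℝ} (hs : 0 ≤ s) :
    (Real.sqrt ∘ fun _ : n => s ^ 2) = fun _ => s :=
  funext fun _ => Real.sqrt_sq hs

theorem isGradAt_of_hasFDerivAt (hN : 0 < N) {F : Matrix (Fin d) (Fin d) ℝ → ℝ}
    {φ : (Fin d → ℝ) → ℝ} {Y : Matrix (Fin d) (Fin d) ℝ} (hY : IsUnit Y)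
    {U : orthogonalGroup (Fin d) ℝ} (hU : Yᵀ * Y = conjDiagonal U (sv Y ^ 2))
    (hφ : DifferentiableAt ℝ φ (sv Y))
    (hF : HasFDerivAt F (traceMulLeft (conjDiagonal U (partials (fun m => φ (Real.sqrt ∘ m))
      (sv Y ^ 2))) ∘L gramDeriv Y) Y) :
    IsGradAt N F Y (Y * conjDiagonal U (gradWeights N φ (sv Y))) := by
  have hs := sv_pos hY
  have h_partials : (2 : ℝ) • partials (fun m => φ (Real.sqrt ∘ m)) (sv Y ^ 2)
      = fun i => (sv Y i)⁻¹ * partials φ (sv Y) i := by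
    ext i
    rw [Pi.smul_apply, partials_comp_coordinates (l := sv Y ^ 2) (by rwa [sqrt_comp_sv_sq])
      fun j => hasDerivAt_sqrt_sq (hs j), sqrt_comp_sv_sq, smul_eq_mul]
    field_simp
  have h_grad := isGradAt_opA (isUnit_opA hN hY) hF.differentiableAt fun W =>
    (congrArg (· W) hF.fderiv).trans (trace_mul_gramDeriv (isSymm_conjDiagonal U _) Y W)
  rwa [← map_smul, h_partials, opA_mul_conjDiagonal hN hs hU] at h_grad

theorem eventually_isGradAt_of_isSymmFun (hN : 0 < N) {F : Matrix (Fin d) (Fin d) ℝ → ℝ}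
    {φ : (Fin d → ℝ) → ℝ} (hF : ∀ Y, IsUnit Y → F Y = φ (sv Y)) (hsymm : IsSymmFun φ) {σ : ℝ}
    (hσ : 0 < σ) (hφ : ContDiffAt ℝ 2 φ fun _ => σ) {X : Matrix (Fin d) (Fin d) ℝ} (hX : IsUnit X)
    (hXX : Xᵀ * X = σ ^ 2 • 1) {U : Matrix (Fin d) (Fin d) ℝ → orthogonalGroup (Fin d) ℝ}
    (hU : ∀ Y, Yᵀ * Y = conjDiagonal (U Y) (sv Y ^ 2)) :
    ∀ᶠ Y in 𝓝 X, IsGradAt N F Y (Y * conjDiagonal (U Y) (gradWeights N φ (sv Y))) := by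
  have h_gram (Y) : HasFDerivAt (fun Y => conjDiagonal (U Y) (sv Y ^ 2)) (gramDeriv Y) Y := by
    simpa only [hU] using hasFDerivAt_gram Y
  have hψ : ContDiffAt ℝ 2 (fun m => φ (Real.sqrt ∘ m)) fun _ => σ ^ 2 :=
    contDiffAt_comp_coordinates (by rwa [sqrt_comp_sq_const hσ.le])
      fun _ => Real.contDiffAt_sqrt (by positivity)
  have h_sv : Tendsto sv (𝓝 X) (𝓝 fun _ => σ) := by
    have h_sq := tendsto_of_continuousAt_conjDiagonal (h_gram X).continuousAt (sv_sq_eq_const hXX)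
    have h_sqrt := (hasFDerivAt_comp_coordinates (l := fun _ : Fin d => σ ^ 2)
      fun _ => hasDerivAt_sqrt_sq hσ).continuousAt.tendsto.comp h_sq
    simpa only [Function.comp_def, Real.sqrt_sq hσ.le, Pi.pow_apply, Real.sqrt_sq (sv_nonneg _ _)]
      using h_sqrt
  filter_upwards [(eventually_isUnit hX).eventually_nhds,
    h_sv.eventually (eventually_differentiableAt_of_contDiffAt hφ),
    eventually_hasFDerivAt_comp_of_isSymmFun (h_gram X).continuousAt (sv_sq_eq_const hXX)
      (hsymm.comp_coordinates Real.sqrt) hψ] with Y hY hφY hFY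
  refine isGradAt_of_hasFDerivAt hN hY.self_of_nhds (hU Y) hφY ?_
  refine (hFY _ (h_gram Y)).congr_of_eventuallyEq (hY.mono fun Z hZ => ?_)
  simp only [hF Z hZ, sqrt_comp_sv_sq]

theorem hasFDerivAt_gradWeights (N : ℕ) {φ : (Fin d → ℝ) → ℝ} {σ : ℝ} (hσ : 0 < σ)
    (hφ : ContDiffAt ℝ 2 φ fun _ => σ) (h_crit : partials φ (fun _ => σ) = 0) {θ₁ θp : ℝ}
    (hH : HasEigs (hess φ fun _ => σ) θ₁ θp) :
    HasFDerivAt (gradWeights N φ)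
      ((N * σ ^ (2 - 2 / (N : ℝ)) * σ⁻¹) • isotropicPi θp ((θ₁ - θp) / d)) fun _ => σ := by
  rw [hasFDerivAt_pi']
  intro i
  have h_apply := hasFDerivAt_apply (𝕜 := ℝ) i (fun _ : Fin d => σ)
  have h_rpow := (h_apply.rpow_const (p := 2 - 2 / (N : ℝ)) (Or.inl hσ.ne')).const_mul (N : ℝ)
  have h_inv := (hasDerivAt_inv hσ.ne').comp_hasFDerivAt (fun _ => σ) h_apply
  have h_partials := hasFDerivAt_pi'.mp (hasFDerivAt_partials_of_hasEigs hφ hH) i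
  refine (h_rpow.mul (h_inv.mul h_partials)).congr_fderiv ?_
  simp [h_crit, mul_smul]

theorem isUnit_of_transpose_mul_self {X : Matrix (Fin d) (Fin d) ℝ} {s : ℝ} (hs : s ≠ 0)
    (hX : Xᵀ * X = s • 1) : IsUnit X :=
  IsUnit.of_mul_eq_one_right (s⁻¹ • Xᵀ) (by rw [smul_mul_assoc, hX, inv_smul_smul₀ hs])

theorem exists_eventually_grad_eq (hN : 0 < N) {F : Matrix (Fin d) (Fin d) ℝ → ℝ}
    {φ : (Fin d → ℝ) → ℝ} (hF : ∀ Y, IsUnit Y → F Y = φ (sv Y)) (hsymm : IsSymmFun φ) {σ : ℝ}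
    (hσ : 0 < σ) (hφ : ContDiffAt ℝ 2 φ fun _ => σ) {X : Matrix (Fin d) (Fin d) ℝ}
    (hXX : Xᵀ * X = σ ^ 2 • 1) :
    ∃ U : Matrix (Fin d) (Fin d) ℝ → orthogonalGroup (Fin d) ℝ,
      (∀ Y, Yᵀ * Y = conjDiagonal (U Y) (sv Y ^ 2)) ∧
      ∀ᶠ Y in 𝓝 X, IsGradAt N F Y (grad N F Y) ∧
        grad N F Y = Y * conjDiagonal (U Y) (gradWeights N φ (sv Y)) := by
  choose U hU using exists_eq_conjDiagonal_sv_sq (d := d)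
  have hX : IsUnit X := isUnit_of_transpose_mul_self (by positivity) hXX
  refine ⟨U, hU, ?_⟩
  filter_upwards [eventually_isUnit hX,
    eventually_isGradAt_of_isSymmFun hN hF hsymm hσ hφ hX hXX hU] with Y hY hgrad
  exact ⟨hgrad.isGradAt_grad, hgrad.isGradAt_grad.eq_of_isUnit (isUnit_opA hN hY) hgrad⟩

/-- The operator `W ↦ -(N σ^{2-2/N} / (2 σ²)) X A(Xᵀ W + Wᵀ X)` with `A` the isotropic operator
with eigenvalues `θ₁` on `1` and `θp` on the traceless symmetric matrices. It is the linearization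
at `X` of the gradient flow of a function whose Hessian in the singular values has these
eigenvalues. -/
noncomputable def linearization (N : ℕ) (σ θ₁ θp : ℝ) (X : Matrix (Fin d) (Fin d) ℝ) :
    Matrix (Fin d) (Fin d) ℝ →L[ℝ] Matrix (Fin d) (Fin d) ℝ :=
  (-(N * σ ^ (2 - 2 / (N : ℝ)) / (2 * σ ^ 2))) • ((LinearMap.mulLeft ℝ X).toContinuousLinearMap ∘L
    isotropicMatrix θp ((θ₁ - θp) / d) ∘L gramDeriv X)

theorem linearization_apply (N : ℕ) (σ θ₁ θp : ℝ) (X W : Matrix (Fin d) (Fin d) ℝ) :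
    linearization N σ θ₁ θp X W = (-(N * σ ^ (2 - 2 / (N : ℝ)) / (2 * σ ^ 2))) •
      (X * isotropicMatrix θp ((θ₁ - θp) / d) (gramDeriv X W)) :=
  rfl

theorem gradWeights_const_eq_zero (N : ℕ) {φ : (Fin d → ℝ) → ℝ} {σ : ℝ}
    (h_crit : partials φ (fun _ => σ) = 0) : gradWeights N φ (fun _ => σ) = 0 := by
  ext i
  simp [gradWeights, h_crit]

theorem sv_eq_const {X : Matrix (Fin d) (Fin d) ℝ} {σ : ℝ} (hσ : 0 ≤ σ)
    (hXX : Xᵀ * X = σ ^ 2 • 1) : sv X = fun _ => σ := by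
  rw [← sqrt_comp_sv_sq, sv_sq_eq_const hXX, sqrt_comp_sq_const hσ]

theorem hasFDerivAt_neg_mul_conjDiagonal_gradWeights (N : ℕ) {φ : (Fin d → ℝ) → ℝ} {σ : ℝ}
    (hσ : 0 < σ) (hφ : ContDiffAt ℝ 2 φ fun _ => σ) (h_crit : partials φ (fun _ => σ) = 0)
    {θ₁ θp : ℝ} (hH : HasEigs (hess φ fun _ => σ) θ₁ θp) {X : Matrix (Fin d) (Fin d) ℝ}
    (hXX : Xᵀ * X = σ ^ 2 • 1) {U : Matrix (Fin d) (Fin d) ℝ → orthogonalGroup (Fin d) ℝ}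
    (hU : ∀ Y, Yᵀ * Y = conjDiagonal (U Y) (sv Y ^ 2)) :
    HasFDerivAt (fun Y => -(Y * conjDiagonal (U Y) (gradWeights N φ (sv Y))))
      (linearization N σ θ₁ θp X) X := by
  set k := N * σ ^ (2 - 2 / (N : ℝ)) / (2 * σ ^ 2)
  have h_gram : HasFDerivAt (fun Y => conjDiagonal (U Y) (sv Y ^ 2)) (gramDeriv X) X := by
    simpa only [hU] using hasFDerivAt_gram X
  have h_weights : HasFDerivAt (fun l => gradWeights N φ (Real.sqrt ∘ l))
      (k • isotropicPi θp ((θ₁ - θp) / d)) fun _ => σ ^ 2 := by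
    have h_outer := hasFDerivAt_gradWeights N hσ hφ h_crit hH
    rw [← sqrt_comp_sq_const hσ.le] at h_outer
    refine (h_outer.comp _ (hasFDerivAt_comp_coordinates fun _ =>
      hasDerivAt_sqrt_sq hσ)).congr_fderiv ?_
    ext v i
    simp [isotropicPi, ← Finset.mul_sum, k]
    field_simp
  have h_conj := hasFDerivAt_conjDiagonal_comp h_gram (sv_sq_eq_const hXX) h_weights
    (by rw [sqrt_comp_sq_const hσ.le, gradWeights_const_eq_zero N h_crit])
    (A := k • isotropicMatrix θp ((θ₁ - θp) / d))
    (fun U a => by simp [isotropicMatrix_conjDiagonal])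
  simp only [sqrt_comp_sv_sq] at h_conj
  refine ((hasFDerivAt_id X).mul' h_conj).neg.congr_fderiv ?_
  ext1 W
  simp [linearization_apply, sv_eq_const hσ.le hXX, gradWeights_const_eq_zero N h_crit, k]

theorem linearization_mul_of_skew (N : ℕ) (θ₁ θp : ℝ) {σ : ℝ} {X A : Matrix (Fin d) (Fin d) ℝ}
    (hXX : Xᵀ * X = σ ^ 2 • 1) (hA : Aᵀ = -A) : linearization N σ θ₁ θp X (X * A) = 0 := by
  have h_gram : gramDeriv X (X * A) = 0 := by
    rw [gramDeriv_apply, transpose_mul, ← mul_assoc, mul_assoc Aᵀ, hXX, hA]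
    simp
  rw [linearization_apply, h_gram, map_zero, mul_zero, smul_zero]

theorem linearization_self (hd : 0 < d) (N : ℕ) (θ₁ θp : ℝ) {σ : ℝ} (hσ : 0 < σ)
    {X : Matrix (Fin d) (Fin d) ℝ} (hXX : Xᵀ * X = σ ^ 2 • 1) :
    linearization N σ θ₁ θp X X = (-(N * σ ^ (2 - 2 / (N : ℝ)) * θ₁)) • X := by
  have h_gram : gramDeriv X X = (2 * σ ^ 2) • 1 := by
    rw [gramDeriv_apply, hXX, ← two_smul ℝ, smul_smul]
  have h_isotropic : isotropicMatrix θp ((θ₁ - θp) / d) (1 : Matrix (Fin d) (Fin d) ℝ)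
      = θ₁ • 1 := by
    rw [isotropicMatrix_apply, trace_one, Fintype.card_fin, smul_smul, ← add_smul]
    congr 1
    field_simp
    ring
  rw [linearization_apply, h_gram, map_smul, h_isotropic, mul_smul_comm, mul_smul_comm, mul_one,
    smul_smul, smul_smul]
  congr 1
  field_simp

theorem linearization_smul_mul_of_isSymm (N : ℕ) (θ₁ θp : ℝ) {σ : ℝ} (hσ : 0 < σ)
    {Q S : Matrix (Fin d) (Fin d) ℝ} (hQ : Qᵀ * Q = 1) (hS : Sᵀ = S) (hS0 : S.trace = 0) :
    linearization N σ θ₁ θp (σ • Q) (Q * S) = (-(N * σ ^ (2 - 2 / (N : ℝ)) * θp)) • (Q * S) := by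
  have h_gram : gramDeriv (σ • Q) (Q * S) = (2 * σ) • S := by
    rw [gramDeriv_apply, transpose_smul, smul_mul_assoc, mul_smul_comm, transpose_mul, ← mul_assoc,
      mul_assoc Sᵀ, hQ, hS, one_mul, mul_one, ← add_smul, two_mul]
  have h_isotropic : isotropicMatrix θp ((θ₁ - θp) / d) S = θp • S := by
    rw [isotropicMatrix_apply, hS0, zero_smul, smul_zero, add_zero]
  rw [linearization_apply, h_gram, map_smul, h_isotropic, smul_mul_assoc, mul_smul_comm,
    mul_smul_comm, smul_smul, smul_smul, smul_smul]
  congr 1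
  field_simp

end SpectralGradient

section EnergyEntropy

variable {N d : ℕ} {f g : ℝ → ℝ} {σ : ℝ}

theorem isSymmFun_energyOf (f g : ℝ → ℝ) : IsSymmFun (energyOf (d := d) f g) := fun π x =>
  congrArg g (Equiv.sum_comp π fun i => f (x i))

theorem contDiffAt_energyOf (hf : ContDiffAt ℝ 2 f σ) (hg : ContDiffAt ℝ 2 g (d * f σ)) :
    ContDiffAt ℝ 2 (energyOf f g) fun _ : Fin d => σ := by
  have h_sum : ContDiffAt ℝ 2 (fun s : Fin d → ℝ => ∑ i, f (s i)) fun _ => σ :=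
    ContDiffAt.sum fun i _ => hf.comp (fun _ : Fin d => σ) (contDiffAt_apply ℝ ℝ i _)
  exact ContDiffAt.comp (g := g) (fun _ : Fin d => σ) (by simpa using hg) h_sum

theorem hasDerivAt_energyOf_const (hf : DifferentiableAt ℝ f σ)
    (hg : DifferentiableAt ℝ g (d * f σ)) :
    HasDerivAt (fun t => energyOf f g fun _ : Fin d => t) (d * (deriv g (d * f σ) * deriv f σ))
      σ := by
  have h_comp := hg.hasDerivAt.comp σ (hf.hasDerivAt.const_mul (d : ℝ))
  have h_energy : (fun t => energyOf f g fun _ : Fin d => t) = g ∘ fun t => d * f t := by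
    ext t
    simp [energyOf]
  rw [h_energy, ← mul_left_comm]
  exact h_comp

theorem ratio_comm (N : ℕ) (a b : ℝ) : ratio N a b = ratio N b a := by
  rcases eq_or_ne a b with rfl | h
  · rfl
  · rw [ratio, ratio, if_neg h, if_neg h.symm, ← neg_sub (b ^ 2), ← neg_sub (b ^ (2 / (N : ℝ))),
      neg_div_neg_eq]

theorem sum_eq_two_mul_sum_lt_add_sum_diag {ι : Type*} [Fintype ι] [LinearOrder ι] {k : ι → ι → ℝ}
    (hk : ∀ i j, k i j = k j i) :
    ∑ i, ∑ j, k i j = 2 * ∑ i, ∑ j with i < j, k i j + ∑ i, k i i := by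
  have h_lower : ∑ i, ∑ j with i < j, k i j = ∑ i, ∑ j with j < i, k i j := by
    simp only [Finset.sum_filter]
    rw [Finset.sum_comm]
    simp only [hk]
  have h_diag : ∑ i, k i i = ∑ i, ∑ j with i = j, k i j := by simp [Finset.sum_filter]
  rw [two_mul, h_diag]
  nth_rw 2 [h_lower]
  simp only [Finset.sum_filter, ← Finset.sum_add_distrib]
  refine Finset.sum_congr rfl fun i _ => Finset.sum_congr rfl fun j _ => ?_
  rcases lt_trichotomy i j with h | h | h
  · simp [h, h.not_gt, h.ne]
  · simp [h]
  · simp [h, h.not_gt, h.ne']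

theorem isSymmFun_entropyOf (N : ℕ) (c : ℝ) : IsSymmFun (entropyOf N c (d := d)) := fun π x => by
  have h_pairs (y : Fin d → ℝ) := sum_eq_two_mul_sum_lt_add_sum_diag
    (k := fun i j => Real.log (ratio N (y i) (y j))) fun i j => by rw [ratio_comm]
  have h_double : ∑ i, ∑ j, Real.log (ratio N (x (π i)) (x (π j)))
      = ∑ i, ∑ j, Real.log (ratio N (x i) (x j)) :=
    (Equiv.sum_comp π fun i => ∑ j, Real.log (ratio N (x i) (x (π j)))).trans <|
      Finset.sum_congr rfl fun i _ => Equiv.sum_comp π fun j => Real.log (ratio N (x i) (x j))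
  have h_diag := Equiv.sum_comp π fun i => Real.log (ratio N (x i) (x i))
  have hx := h_pairs x
  have hxπ := h_pairs (x ∘ π)
  simp only [Function.comp_apply] at hxπ
  simp only [entropyOf, Function.comp_apply]
  linarith

theorem contDiffAt_ratio (hN : 0 < N) {a b : ℝ} (ha : 0 < a) (hb : 0 < b) :
    ContDiffAt ℝ 2 (fun p : ℝ × ℝ => ratio N p.1 p.2) (a, b) := by
  have h_pos : ∀ᶠ p : ℝ × ℝ in 𝓝 (a, b), 0 < p.1 ∧ 0 < p.2 :=
    (continuous_fst.continuousAt.eventually (lt_mem_nhds ha)).and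
      (continuous_snd.continuousAt.eventually (lt_mem_nhds hb))
  refine ContDiffAt.congr_of_eventuallyEq ?_
    (h_pos.mono fun p hp => ratio_eq_sum hN hp.1 hp.2)
  exact ContDiffAt.sum fun p _ =>
    ((contDiffAt_fst.pow 2).rpow_const_of_ne (by positivity)).mul
      ((contDiffAt_snd.pow 2).rpow_const_of_ne (by positivity))

theorem contDiffAt_entropyOf (hN : 0 < N) (c : ℝ) {s : Fin d → ℝ} (hs : ∀ i, 0 < s i) :
    ContDiffAt ℝ 2 (entropyOf N c) s := by
  have h_ratio (i j : Fin d) : ContDiffAt ℝ 2 (fun t : Fin d → ℝ => ratio N (t i) (t j)) s :=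
    (contDiffAt_ratio hN (hs i) (hs j)).comp s
      ((contDiffAt_apply ℝ ℝ i s).prodMk (contDiffAt_apply ℝ ℝ j s))
  exact contDiffAt_const.add <| contDiffAt_const.mul <| ContDiffAt.sum fun i _ =>
    ContDiffAt.sum fun j _ => (h_ratio i j).log (ratio_pos hN (hs i) (hs j)).ne'

theorem entropyOf_const (N d : ℕ) (c t : ℝ) :
    entropyOf N c (fun _ : Fin d => t) = ((N : ℝ) - 1) * c
      + (d : ℝ) * (d - 1) / 4 * Real.log (N * t ^ (2 - 2 / (N : ℝ))) := by
  have h_pairs : (d : ℝ) * d = 2 * ∑ i : Fin d, ∑ j with i < j, (1 : ℝ) + d := by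
    simpa only [Finset.sum_const, Finset.card_univ, Fintype.card_fin, nsmul_eq_mul, mul_one]
      using sum_eq_two_mul_sum_lt_add_sum_diag (ι := Fin d) (k := fun _ _ => 1) fun _ _ => rfl
  have h_card : ∑ i : Fin d, ∑ j with i < j, (1 : ℝ) = d * (d - 1) / 2 := by linarith
  have h_sum : ∑ i : Fin d, ∑ j with i < j, Real.log (ratio N t t)
      = (∑ i : Fin d, ∑ j with i < j, (1 : ℝ)) * Real.log (ratio N t t) := by
    simp only [Finset.sum_mul, one_mul]
  rw [entropyOf, h_sum, h_card, ratio_self]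
  ring

theorem hasDerivAt_entropyOf_const (hN : 0 < N) (c : ℝ) (hσ : 0 < σ) :
    HasDerivAt (fun t => entropyOf N c fun _ : Fin d => t)
      (d * (((d : ℝ) - 1) / (2 * σ) * (1 - 1 / (N : ℝ)))) σ := by
  simp_rw [entropyOf_const]
  have hN' : (0 : ℝ) < N := Nat.cast_pos.mpr hN
  have h_rpow := (Real.hasDerivAt_rpow_const (p := 2 - 2 / (N : ℝ)) (Or.inl hσ.ne')).const_mul
    (N : ℝ)
  have h_pos : 0 < σ ^ (2 - 2 / (N : ℝ)) := Real.rpow_pos_of_pos hσ _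
  refine (((h_rpow.log (mul_pos hN' h_pos).ne').const_mul _).const_add _).congr_deriv ?_
  rw [Real.rpow_sub_one hσ.ne']
  field_simp
  ring

end EnergyEntropy

section Orbit

variable {d : ℕ}

theorem hasDerivAt_exp_smul (A : Matrix (Fin d) (Fin d) ℝ) :
    HasDerivAt (fun t : ℝ => NormedSpace.exp (t • A)) A 0 := by
  simpa using hasDerivAt_exp_smul_const (𝕂 := ℝ) A 0

theorem exp_mem_orthogonalGroup {A : Matrix (Fin d) (Fin d) ℝ} (hA : Aᵀ = -A) :
    NormedSpace.exp A ∈ orthogonalGroup (Fin d) ℝ := by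
  rw [mem_orthogonalGroup_iff, ← exp_transpose, hA, Matrix.exp_neg, mul_nonsing_inv]
  exact (isUnit_iff_isUnit_det _).mp (isUnit_exp A)

theorem transpose_mul_self_of_mem_orbit {X : Matrix (Fin d) (Fin d) ℝ} {σ : ℝ}
    (hX : X ∈ orbit d σ) : Xᵀ * X = σ ^ 2 • 1 := by
  obtain ⟨R, hR, rfl⟩ := hX
  rw [transpose_smul, smul_mul_smul_comm, (mem_orthogonalGroup_iff' _ _).mp hR, sq]

theorem gramDeriv_eq_zero_of_hasDerivAt {γ : ℝ → Matrix (Fin d) (Fin d) ℝ}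
    {C Z : Matrix (Fin d) (Fin d) ℝ} {t : ℝ} (hγ : HasDerivAt γ Z t)
    (hC : ∀ t, (γ t)ᵀ * γ t = C) : gramDeriv (γ t) Z = 0 := by
  have h_comp := (hasFDerivAt_gram (γ t)).comp_hasDerivAt t hγ
  rw [show (fun Y => Yᵀ * Y) ∘ γ = fun _ => C from funext hC] at h_comp
  exact h_comp.unique (hasDerivAt_const t C)

/-- The subspace `{X A : Aᵀ = -A}`, the tangent space at `X` of the matrices with the same Gram
matrix as an invertible `X`. -/
def skewSpace (X : Matrix (Fin d) (Fin d) ℝ) : Submodule ℝ (Matrix (Fin d) (Fin d) ℝ) where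
  carrier := {Z | ∃ A : Matrix (Fin d) (Fin d) ℝ, Aᵀ = -A ∧ Z = X * A}
  add_mem' := by
    rintro _ _ ⟨A, hA, rfl⟩ ⟨B, hB, rfl⟩
    exact ⟨A + B, by rw [transpose_add, hA, hB, neg_add], by rw [mul_add]⟩
  zero_mem' := ⟨0, by simp, by simp⟩
  smul_mem' := by
    rintro a _ ⟨A, hA, rfl⟩
    exact ⟨a • A, by rw [transpose_smul, hA, smul_neg], by rw [mul_smul_comm]⟩

theorem skewSpace_smul {a : ℝ} (ha : a ≠ 0) (X : Matrix (Fin d) (Fin d) ℝ) :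
    skewSpace (a • X) = skewSpace X := by
  ext Z
  constructor
  · rintro ⟨A, hA, rfl⟩
    exact ⟨a • A, by rw [transpose_smul, hA, smul_neg], by rw [smul_mul_assoc, mul_smul_comm]⟩
  · rintro ⟨A, hA, rfl⟩
    exact ⟨a⁻¹ • A, by rw [transpose_smul, hA, smul_neg],
      by rw [smul_mul_smul_comm, mul_inv_cancel₀ ha, one_smul]⟩

theorem tangentSpaceAt_orbit {X : Matrix (Fin d) (Fin d) ℝ} {σ : ℝ} (hσ : σ ≠ 0)
    (hX : X ∈ orbit d σ) : tangentSpaceAt (orbit d σ) X = skewSpace X := by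
  refine le_antisymm (Submodule.span_le.mpr ?_) ?_
  · rintro Z ⟨γ, hγ, rfl, hZ⟩
    have h_gram := gramDeriv_eq_zero_of_hasDerivAt hZ fun t =>
      transpose_mul_self_of_mem_orbit (hγ t)
    rw [gramDeriv_apply] at h_gram
    have h_scaled : ((σ ^ 2)⁻¹ • (γ 0)ᵀ) * γ 0 = 1 := by
      rw [smul_mul_assoc, transpose_mul_self_of_mem_orbit hX, inv_smul_smul₀ (pow_ne_zero 2 hσ)]
    refine ⟨(σ ^ 2)⁻¹ • ((γ 0)ᵀ * Z), ?_, ?_⟩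
    · rw [transpose_smul, transpose_mul, transpose_transpose, ← smul_neg,
        eq_neg_of_add_eq_zero_right h_gram]
    · rw [← smul_mul_assoc, ← mul_assoc, mul_eq_one_comm.mp h_scaled, one_mul]
  · rintro _ ⟨A, hA, rfl⟩
    refine Submodule.subset_span ⟨fun t => X * NormedSpace.exp (t • A), fun t => ?_, by simp, ?_⟩
    · obtain ⟨R, hR, rfl⟩ := hX
      have hA' : (t • A)ᵀ = -(t • A) := by rw [transpose_smul, hA, smul_neg]
      exact ⟨_, mul_mem hR (exp_mem_orthogonalGroup hA'), smul_mul_assoc _ _ _⟩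
    · exact (hasDerivAt_exp_smul A).const_mul X

theorem isInternal_three {R M : Type*} [Ring R] [AddCommGroup M] [Module R M]
    {p q r : Submodule R M}
    (h_indep : ∀ x ∈ p, ∀ y ∈ q, ∀ z ∈ r, x + y + z = 0 → x = 0 ∧ y = 0 ∧ z = 0)
    (h_span : ∀ m, ∃ x ∈ p, ∃ y ∈ q, ∃ z ∈ r, x + y + z = m) :
    DirectSum.IsInternal ![p, q, r] := by
  rw [DirectSum.isInternal_submodule_iff_iSupIndep_and_iSup_eq_top]
  refine ⟨(iSupIndep_iff_finsetSum_eq_zero_imp_eq_zero _).mpr fun s v hv h_sum => ?_,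
    eq_top_iff.mpr fun m _ => ?_⟩
  · set u : Fin 3 → M := fun i => if i ∈ s then v i else 0 with hu
    have hu_mem (i : Fin 3) : u i ∈ ![p, q, r] i := by
      by_cases hi : i ∈ s
      · simpa only [hu, if_pos hi] using hv i hi
      · simp only [hu, if_neg hi, Submodule.zero_mem]
    have hu_sum : u 0 + u 1 + u 2 = 0 := by
      rw [← Fin.sum_univ_three, hu, Finset.sum_ite_mem, Finset.univ_inter, h_sum]
    obtain ⟨h0, h1, h2⟩ := h_indep _ (hu_mem 0) _ (hu_mem 1) _ (hu_mem 2) hu_sum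
    have hu_zero : ∀ i, u i = 0 := Fin.forall_fin_succ.mpr
      ⟨h0, Fin.forall_fin_two.mpr ⟨h1, h2⟩⟩
    exact fun i hi => by simpa only [hu, if_pos hi] using hu_zero i
  · obtain ⟨x, hx, y, hy, z, hz, rfl⟩ := h_span m
    have h_le (i : Fin 3) : ![p, q, r] i ≤ ⨆ i, ![p, q, r] i := le_iSup _ i
    exact add_mem (add_mem (h_le 0 hx) (h_le 1 hy)) (h_le 2 hz)

theorem eq_zero_of_skew_add_scalar_add_isSymm (hd : 0 < d) {A S : Matrix (Fin d) (Fin d) ℝ} {a : ℝ}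
    (hA : Aᵀ = -A) (hS : Sᵀ = S) (hS0 : S.trace = 0) (h : A + a • 1 + S = 0) :
    A = 0 ∧ a = 0 ∧ S = 0 := by
  have h_transpose : -A + a • 1 + S = 0 := by
    simpa only [transpose_add, transpose_smul, transpose_one, transpose_zero, hA, hS]
      using congrArg transpose h
  have hA0 : A = 0 := by
    have h_two : (2 : ℝ) • A = 0 := by
      rw [← sub_self (0 : Matrix (Fin d) (Fin d) ℝ)]
      nth_rewrite 1 [← h]
      rw [← h_transpose]
      module
    exact (smul_eq_zero.mp h_two).resolve_left two_ne_zero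
  subst hA0
  have ha : a = 0 := by
    have h_trace := congrArg trace h
    rw [trace_add, trace_add, trace_smul, trace_one, hS0, trace_zero, zero_add, add_zero,
      Fintype.card_fin, smul_eq_mul] at h_trace
    exact (mul_eq_zero.mp h_trace).resolve_right (Nat.cast_ne_zero.mpr hd.ne')
  subst ha
  exact ⟨rfl, rfl, by simpa using h⟩

theorem exists_skew_add_scalar_add_isSymm (hd : 0 < d) (B : Matrix (Fin d) (Fin d) ℝ) :
    ∃ (A : Matrix (Fin d) (Fin d) ℝ) (a : ℝ) (S : Matrix (Fin d) (Fin d) ℝ),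
      Aᵀ = -A ∧ Sᵀ = S ∧ S.trace = 0 ∧ A + a • 1 + S = B := by
  refine ⟨(2 : ℝ)⁻¹ • (B - Bᵀ), B.trace / d, (2 : ℝ)⁻¹ • (B + Bᵀ) - (B.trace / d) • 1,
    ?_, ?_, ?_, by module⟩
  · rw [transpose_smul, transpose_sub, transpose_transpose, ← smul_neg, neg_sub]
  · rw [transpose_sub, transpose_smul, transpose_add, transpose_transpose, transpose_smul,
      transpose_one, add_comm]
  · rw [trace_sub, trace_smul, trace_add, trace_transpose, trace_smul, trace_one,
      Fintype.card_fin, smul_eq_mul, smul_eq_mul, div_mul_cancel₀ _ (Nat.cast_ne_zero.mpr hd.ne')]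
    ring

theorem isInternal_skewSpace_span_shapeSpace (hd : 0 < d) {Q : Matrix (Fin d) (Fin d) ℝ}
    (hQ : Qᵀ * Q = 1) :
    DirectSum.IsInternal ![skewSpace Q, Submodule.span ℝ {Q}, shapeSpace Q] := by
  have h_cancel (B : Matrix (Fin d) (Fin d) ℝ) : Qᵀ * (Q * B) = B := by
    rw [← mul_assoc, hQ, one_mul]
  have h_factor (A S : Matrix (Fin d) (Fin d) ℝ) (a : ℝ) :
      Q * A + a • Q + Q * S = Q * (A + a • 1 + S) := by
    rw [mul_add, mul_add, mul_smul_comm, mul_one]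
  refine isInternal_three ?_ fun Z => ?_
  · rintro _ ⟨A, hA, rfl⟩ y hy _ ⟨S, hS, hS0, rfl⟩ h
    obtain ⟨a, rfl⟩ := Submodule.mem_span_singleton.mp hy
    obtain ⟨rfl, rfl, rfl⟩ := eq_zero_of_skew_add_scalar_add_isSymm hd hA hS hS0
      (by rw [← h_cancel (A + a • 1 + S), ← h_factor, h, mul_zero])
    exact ⟨mul_zero Q, zero_smul ℝ Q, mul_zero Q⟩
  · obtain ⟨A, a, S, hA, hS, hS0, h⟩ := exists_skew_add_scalar_add_isSymm hd (Qᵀ * Z)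
    refine ⟨_, ⟨A, hA, rfl⟩, _, Submodule.smul_mem _ a (Submodule.mem_span_singleton_self Q),
      _, ⟨S, hS, hS0, rfl⟩, ?_⟩
    rw [h_factor, h, ← mul_assoc, mul_eq_one_comm.mp hQ, one_mul]

theorem isInternal_tangentSpaceAt_orbit (hd : 0 < d) {Q : Matrix (Fin d) (Fin d) ℝ} {σ : ℝ}
    (hσ : σ ≠ 0) (hQ : Q ∈ orthogonalGroup (Fin d) ℝ) :
    DirectSum.IsInternal
      ![tangentSpaceAt (orbit d σ) (σ • Q), Submodule.span ℝ {σ • Q}, shapeSpace Q] := by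
  rw [tangentSpaceAt_orbit hσ ⟨Q, hQ, rfl⟩, skewSpace_smul hσ,
    Submodule.span_singleton_smul_eq (IsUnit.mk0 σ hσ)]
  exact isInternal_skewSpace_span_shapeSpace hd ((mem_orthogonalGroup_iff' _ _).mp hQ)

end Orbit

section FreeEnergy

variable {N d : ℕ} {c β σ : ℝ} {f g : ℝ → ℝ}

theorem grad_linearization (hN : 0 < N) {F : Matrix (Fin d) (Fin d) ℝ → ℝ} {φ : (Fin d → ℝ) → ℝ}
    (hF : ∀ Y, IsUnit Y → F Y = φ (sv Y)) (hsymm : IsSymmFun φ) (hσ : 0 < σ)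
    (hφ : ContDiffAt ℝ 2 φ fun _ => σ) (h_crit : partials φ (fun _ => σ) = 0) {θ₁ θp : ℝ}
    (hH : HasEigs (hess φ fun _ => σ) θ₁ θp) {X : Matrix (Fin d) (Fin d) ℝ}
    (hXX : Xᵀ * X = σ ^ 2 • 1) :
    (∀ᶠ Y in 𝓝 X, IsGradAt N F Y (grad N F Y)) ∧ grad N F X = 0 ∧
      HasFDerivAt (fun Y => -grad N F Y) (linearization N σ θ₁ θp X) X := by
  obtain ⟨U, hU, h_grad⟩ := exists_eventually_grad_eq hN hF hsymm hσ hφ hXX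
  refine ⟨h_grad.mono fun Y hY => hY.1, ?_, ?_⟩
  · rw [h_grad.self_of_nhds.2, sv_eq_const hσ.le hXX, gradWeights_const_eq_zero N h_crit, map_zero,
      mul_zero]
  · have h_fderiv := hasFDerivAt_neg_mul_conjDiagonal_gradWeights N hσ hφ h_crit hH hXX hU
    exact h_fderiv.congr_of_eventuallyEq (h_grad.mono fun Y hY => congrArg Neg.neg hY.2)

/-- The free energy `F_β = E - β⁻¹ S_N` as a function of the singular values. -/
noncomputable def freeEnergyOf (N : ℕ) (c β : ℝ) (f g : ℝ → ℝ) (s : Fin d → ℝ) : ℝ :=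
  energyOf f g s - β⁻¹ * entropyOf N c s

theorem isSymmFun_freeEnergyOf (N : ℕ) (c β : ℝ) (f g : ℝ → ℝ) :
    IsSymmFun (freeEnergyOf (d := d) N c β f g) := fun π s => by
  rw [freeEnergyOf, isSymmFun_energyOf f g π s, isSymmFun_entropyOf N c π s, freeEnergyOf]

theorem contDiffAt_freeEnergyOf (hN : 0 < N) (c β : ℝ) (hσ : 0 < σ) (hf : ContDiffAt ℝ 2 f σ)
    (hg : ContDiffAt ℝ 2 g (d * f σ)) :
    ContDiffAt ℝ 2 (freeEnergyOf N c β f g) fun _ : Fin d => σ :=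
  (contDiffAt_energyOf hf hg).sub (contDiffAt_const.mul (contDiffAt_entropyOf hN c fun _ => hσ))

theorem partials_freeEnergyOf_const_eq_zero (hN : 0 < N) (hσ : 0 < σ) (hf : ContDiffAt ℝ 2 f σ)
    (hg : ContDiffAt ℝ 2 g (d * f σ))
    (h_balance : deriv g (d * f σ) * deriv f σ
      = β⁻¹ * (((d : ℝ) - 1) / (2 * σ)) * (1 - 1 / (N : ℝ))) :
    partials (freeEnergyOf N c β f g) (fun _ : Fin d => σ) = 0 := by
  refine partials_eq_zero_of_hasDerivAt (isSymmFun_freeEnergyOf N c β f g)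
    ((contDiffAt_freeEnergyOf hN c β hσ hf hg).differentiableAt two_ne_zero) ?_
  have h_deriv := (hasDerivAt_energyOf_const (hf.differentiableAt two_ne_zero)
    (hg.differentiableAt two_ne_zero)).sub
      ((hasDerivAt_entropyOf_const (d := d) hN c hσ).const_mul β⁻¹)
  refine h_deriv.congr_deriv ?_
  rw [h_balance]
  ring

theorem hasEigs_hess_freeEnergyOf (hN : 0 < N) (hσ : 0 < σ) (hf : ContDiffAt ℝ 2 f σ)
    (hg : ContDiffAt ℝ 2 g (d * f σ)) {θ₁E θpE θ₁S θpS : ℝ}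
    (hHE : HasEigs (hess (energyOf f g) fun _ : Fin d => σ) θ₁E θpE)
    (hHS : HasEigs (hess (entropyOf N c) fun _ : Fin d => σ) θ₁S θpS) :
    HasEigs (hess (freeEnergyOf N c β f g) fun _ : Fin d => σ) (θ₁E - β⁻¹ * θ₁S)
      (θpE - β⁻¹ * θpS) := by
  have h_hess := hess_sub_const_mul (contDiffAt_energyOf (d := d) hf hg)
    (contDiffAt_entropyOf hN c fun _ => hσ) β⁻¹
  exact h_hess ▸ hHE.sub_smul hHS β⁻¹

end FreeEnergy

end DLN

open DLN

theorem corollary1p5_general (N d : ℕ) (hN : 0 < N) (hd : 0 < d) (β : ℝ) (_hβ : β ≠ 0) (c : ℝ)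
    (E : Matrix (Fin d) (Fin d) ℝ → ℝ) (f g : ℝ → ℝ)
    (hE : ∀ Y, IsUnit Y → E Y = g (∑ i, f (sv Y i)))
    (σ : ℝ) (hσ : 0 < σ) (hf : ContDiffAt ℝ 2 f σ) (hg : ContDiffAt ℝ 2 g (d * f σ))
    (hbal : deriv g (d * f σ) * deriv f σ
      = β⁻¹ * (((d : ℝ) - 1) / (2 * σ)) * (1 - 1 / (N : ℝ)))
    (Q X : Matrix (Fin d) (Fin d) ℝ) (hQ : Q ∈ orthogonalGroup (Fin d) ℝ) (hX : X = σ • Q) :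
    ∃ θ₁E θpE θ₁S θpS : ℝ,
      HasEigs (hess (energyOf f g) (fun _ : Fin d => σ)) θ₁E θpE ∧
      HasEigs (hess (entropyOf N c) (fun _ : Fin d => σ)) θ₁S θpS ∧
      (∀ᶠ Y in nhds X, IsGradAt N (freeEnergy N c β E) Y
        (grad N (freeEnergy N c β E) Y)) ∧
      grad N (freeEnergy N c β E) X = 0 ∧
      (∀ Z, Z ∈ tangentSpaceAt (orbit d σ) X ↔
        ∃ A : Matrix (Fin d) (Fin d) ℝ, Aᵀ = -A ∧ Z = X * A) ∧
      DirectSum.IsInternal ![tangentSpaceAt (orbit d σ) X,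
        Submodule.span ℝ {X}, shapeSpace Q] ∧
      ∃ L : Matrix (Fin d) (Fin d) ℝ →L[ℝ] Matrix (Fin d) (Fin d) ℝ,
        HasFDerivAt (fun Y => -grad N (freeEnergy N c β E) Y) L X ∧
        (∀ Z ∈ tangentSpaceAt (orbit d σ) X, L Z = 0) ∧
        (∀ Z ∈ Submodule.span ℝ {X}, L Z = rate N β σ θ₁E θ₁S • Z) ∧
        (∀ Z ∈ shapeSpace Q, L Z = rate N β σ θpE θpS • Z) := by
  have h_orbit : X ∈ orbit d σ := ⟨Q, hQ, hX⟩
  have h_tangent := tangentSpaceAt_orbit hσ.ne' h_orbit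
  have hXX := transpose_mul_self_of_mem_orbit h_orbit
  obtain ⟨θ₁E, θpE, hHE⟩ := exists_hasEigs_hess (isSymmFun_energyOf (d := d) f g) σ
  obtain ⟨θ₁S, θpS, hHS⟩ := exists_hasEigs_hess (isSymmFun_entropyOf (d := d) N c) σ
  have hF (Y) (hY : IsUnit Y) : freeEnergy N c β E Y = freeEnergyOf N c β f g (sv Y) :=
    congrArg (· - β⁻¹ * entropy N c Y) (hE Y hY)
  obtain ⟨h_grad, h_equilibrium, h_fderiv⟩ := grad_linearization hN hF
    (isSymmFun_freeEnergyOf N c β f g) hσ (contDiffAt_freeEnergyOf hN c β hσ hf hg)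
    (partials_freeEnergyOf_const_eq_zero hN hσ hf hg hbal)
    (hasEigs_hess_freeEnergyOf hN hσ hf hg hHE hHS) hXX
  refine ⟨θ₁E, θpE, θ₁S, θpS, hHE, hHS, h_grad, h_equilibrium, fun Z => h_tangent ▸ Iff.rfl,
    hX ▸ isInternal_tangentSpaceAt_orbit hd hσ.ne' hQ, _, h_fderiv, ?_, ?_, ?_⟩
  · rw [h_tangent]
    rintro _ ⟨A, hA, rfl⟩
    exact linearization_mul_of_skew N _ _ hXX hA
  · rintro Z hZ
    obtain ⟨a, rfl⟩ := Submodule.mem_span_singleton.mp hZ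
    rw [map_smul, linearization_self hd N _ _ hσ hXX, rate, smul_comm]
  · rintro _ ⟨S, hS, hS0, rfl⟩
    rw [hX, linearization_smul_mul_of_isSymm N _ _ hσ ((mem_orthogonalGroup_iff' _ _).mp hQ) hS hS0,
      rate]

theorem corollary1p5 (N d : ℕ) (hN : 0 < N) (hd : 0 < d) (β : ℝ) (hβ : 0 < β) (c : ℝ)
    (E : Matrix (Fin d) (Fin d) ℝ → ℝ) (f g : ℝ → ℝ) (hE : DLN.IsSpectralEnergy E f g)
    (hf : ContDiffOn ℝ 2 f (Set.Ioi 0)) (hg : ContDiff ℝ 2 g)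
    (σ : ℝ) (hσ : 0 < σ)
    (hbal : deriv g ((d : ℝ) * f σ) * deriv f σ
      = β⁻¹ * (((d : ℝ) - 1) / (2 * σ)) * (1 - 1 / (N : ℝ)))
    (Q X : Matrix (Fin d) (Fin d) ℝ) (hQ : Q ∈ Matrix.orthogonalGroup (Fin d) ℝ)
    (hX : X = σ • Q) :
    -- the eigenvalues of the Euclidean Hessians of `E(σ)` and `S_N(σ)` at `(σ, …, σ)`
    ∃ θ₁E θpE θ₁S θpS : ℝ,
      DLN.HasEigs (DLN.hess (DLN.energyOf f g) (fun _ : Fin d => σ)) θ₁E θpE ∧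
      DLN.HasEigs (DLN.hess (DLN.entropyOf N c) (fun _ : Fin d => σ)) θ₁S θpS ∧
      -- the gradient is well defined near `X`, and `X` is an equilibrium of the flow
      (∀ᶠ Y in nhds X, DLN.IsGradAt N (DLN.freeEnergy N c β E) Y
        (DLN.grad N (DLN.freeEnergy N c β E) Y)) ∧
      DLN.grad N (DLN.freeEnergy N c β E) X = 0 ∧
      -- the splitting
      (∀ Z, Z ∈ DLN.tangentSpaceAt (DLN.orbit d σ) X ↔
        ∃ A : Matrix (Fin d) (Fin d) ℝ, A.transpose = -A ∧ Z = X * A) ∧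
      DirectSum.IsInternal ![DLN.tangentSpaceAt (DLN.orbit d σ) X,
        Submodule.span ℝ {X}, DLN.shapeSpace Q] ∧
      -- the linearization of the flow at `X` is diagonal in the splitting
      ∃ L : Matrix (Fin d) (Fin d) ℝ →L[ℝ] Matrix (Fin d) (Fin d) ℝ,
        HasFDerivAt (fun Y => -DLN.grad N (DLN.freeEnergy N c β E) Y) L X ∧
        (∀ Z ∈ DLN.tangentSpaceAt (DLN.orbit d σ) X, L Z = 0) ∧
        (∀ Z ∈ Submodule.span ℝ {X}, L Z = DLN.rate N β σ θ₁E θ₁S • Z) ∧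
        (∀ Z ∈ DLN.shapeSpace Q, L Z = DLN.rate N β σ θpE θpS • Z) :=
  corollary1p5_general N d hN hd β hβ.ne' c E f g hE.eq σ hσ (hf.contDiffAt (Ioi_mem_nhds hσ))
    hg.contDiffAt hbal Q X hQ hX
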